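/- Let $Z$ be a $q$-dimensional linear subspace of $\mathbb{R}^n$, let $\mu = v_1\wedge\dots\wedge v_k$ with $v_1,\dots,v_k\in Z$ be a simple $k$-vector in $Z$, and let $p\ge 1$ be an integer with $p\le k$ and $p\le q$. For an integer $j\ge 0$ let $$\mathcal U^j_\perp(Z)=\{(u_1,\dots,u_j)\in Z^j : |u_i|=1,\ u_i\cdot u_l=0 \text{ for } i\neq l\}\subseteq(\mathbb{R}^n)^j,$$ where $(\mathbb{R}^n)^j$ carries its Euclidean metric (for $j=0$ this is a single point, and the empty wedge product is $1$). Multivectors carry the inner product determined by $(a_1\wedge\dots\wedge a_m)\cdot(b_1\wedge\dots\wedge b_m)=\det(a_i\cdot b_j)$, and for an $l$-vector $\nu$ and a $k$-vector $\xi$ with $l\le k$, the interior product $\nu\lrcorner\xi$ is the unique $(k-l)$-vector such that $\omega\cdot(\nu\lrcorner\xi)=(\nu\wedge\omega)\cdot\xi$ for all $(k-l)$-vectors $\omega$. Let $\mathcal H^d$ be the $d$-dimensional Hausdorff measure, normalized to agree with Lebesgue measure on $\mathbb{R}^d$. Then both integrands below are integrable, and $$\int_{\mathcal U^p_\perp(Z)}|(u_1\wedge\dots\wedge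 u_p)\lrcorner\mu|\,d\mathcal H^{\frac{p(2q-p-1)}{2}}(u_1,\dots,u_p) =\frac{2^{\frac{p+1}{2}}\,\pi^{\frac{q-p+1}{2}}\,\Gamma\!\left(\frac{k-p+2}{2}\right)}{\Gamma\!\left(\frac{k-p+1}{2}\right)\Gamma\!\left(\frac{q-p+2}{2}\right)}\int_{\mathcal U^{p-1}_\perp(Z)}|(u_1\wedge\dots\wedge u_{p-1})\lrcorner\mu|\,d\mathcal H^{\frac{(p-1)(2q-p)}{2}}(u_1,\dots,u_{p-1}).$$ -/

import Mathlib

open scoped MeasureTheory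

noncomputable section

namespace Multivector

variable {E : Type*} [NormedAddCommGroup E] [InnerProductSpace ℝ E]

/-- Left exterior multiplication by a fixed `l`-vector `ν`, as a linear map
`ω ↦ ν ∧ ω` from `m`-vectors to `k`-vectors, where `l + m = k`. The product is the one of the
exterior algebra. -/
def wedge {l m k : ℕ} (h : l + m = k) (ν : ⋀[ℝ]^l E) : ⋀[ℝ]^m E →ₗ[ℝ] ⋀[ℝ]^k E :=
  (LinearMap.mulLeft ℝ (ν : ExteriorAlgebra ℝ E)).restrict
    (fun ω hω => by
      rw [← h]
      exact SetLike.mul_mem_graded (A := fun i : ℕ => ⋀[ℝ]^i E) ν.2 hω)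

/-- The left interior product `ν ⌟ ξ` of an `l`-vector `ν` with a `k`-vector `ξ`, `l ≤ k`: the
value at `ξ` of the adjoint of `ω ↦ ν ∧ ω` with respect to the inner products of multivectors
(given by Gram determinants on simple multivectors). -/
def interiorProduct [FiniteDimensional ℝ E] {l k : ℕ} (h : l ≤ k) (ν : ⋀[ℝ]^l E)
    (ξ : ⋀[ℝ]^k E) : ⋀[ℝ]^(k - l) E :=
  LinearMap.adjoint (wedge (Nat.add_sub_of_le h) ν) ξ

/-- The interior product `ν ⌟ ξ` is the unique `(k - l)`-vector `η` such that
`ω · η = (ν ∧ ω) · ξ` for all `(k - l)`-vectors `ω`. -/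
theorem eq_interiorProduct_iff [FiniteDimensional ℝ E] {l k : ℕ} (h : l ≤ k) (ν : ⋀[ℝ]^l E)
    (ξ : ⋀[ℝ]^k E) (η : ⋀[ℝ]^(k - l) E) :
    η = interiorProduct h ν ξ ↔
      ∀ ω : ⋀[ℝ]^(k - l) E,
        inner ℝ ω η = inner ℝ (wedge (Nat.add_sub_of_le h) ν ω) ξ := by
  constructor
  · rintro rfl ω
    exact LinearMap.adjoint_inner_right _ _ _
  · intro hη
    refine ext_inner_left ℝ fun ω => ?_
    rw [hη ω]
    exact (LinearMap.adjoint_inner_right _ _ _).symm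

/-- The set of simple `k`-vectors `v₁ ∧ ⋯ ∧ v_k` in the subspace `Z`. -/
def simpleVectors (k : ℕ) (Z : Submodule ℝ E) : Set (⋀[ℝ]^k E) :=
  {ξ | ∃ v : Fin k → E, (∀ i, v i ∈ Z) ∧ ξ = exteriorPower.ιMulti ℝ k v}

/-- The set of `p`-tuples of orthonormal vectors in the subspace `Z`, inside the `p`-fold power
`E ^ p` with its Euclidean (`ℓ²`) product metric. -/
def orthonormalFrames (p : ℕ) (Z : Submodule ℝ E) : Set (PiLp 2 (fun _ : Fin p => E)) :=
  {u | (∀ i, u i ∈ Z) ∧ (∀ i, ‖u i‖ = 1) ∧ ∀ i j, i < j → inner ℝ (u i) (u j) = 0}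

end Multivector

end

/-!
Write `E` for the subspace, `q` for its dimension, and `p + 1` for the length of the longer frames.
An orthonormal frame of length `p + 1` is an orthonormal frame `u` of length `p` followed by a
vector `v` of the unit sphere of `uᗮ`. The formula is the result of integrating over `v` first,
with `u` fixed, and it rests on three facts.

* **Disintegration** (`lintegral_frameMeasure_succ`). The Hausdorff measure on frames of length
  `p + 1` is `2 ^ (p / 2)` times the Hausdorff measure on frames `u` of length `p`, extended by the
  surface measures of the unit spheres of `uᗮ`. The factor is a Jacobian: when `u` moves with
  velocity `ξ`, the vector `v` has to move by `-∑ ⟪ξ i, v⟫ • u i` in order to stay orthogonal to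
  `u`, which stretches the `p` orthonormal directions `ξ = v` (in the `i`-th place) by `√2` and
  leaves the orthogonal directions alone (`normDet_frameLift`). No area formula for manifolds is
  used. Near a frame the secants of the set of frames are almost tangent
  (`norm_sub_frameLift_frameCoord_le`), so that projection to a tangent space distorts Hausdorff
  measure by a factor close to one (`euclideanHausdorffMeasure_comparison`), and an inequality
  between two measures may be checked locally up to factors close to one
  (`measure_restrict_le_of_locally_le`).

* **Algebra** (`Multivector.exists_norm_interiorProduct_snoc`). For a simple `k`-vector `μ`, the
  interior product of `u₁ ∧ ⋯ ∧ u_p` with `μ` is a multiple of `g₁ ∧ ⋯ ∧ g_{k-p}` for an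
  orthonormal family `g` orthogonal to `u`. The interior product with `u₁ ∧ ⋯ ∧ u_p ∧ v` is the
  interior product of `v` with this multivector, and its length is the product of the length of
  the multivector and the length of the projection of `v` to the span of `g`.

* **Mean length of a projection** (`lintegral_fibreMeasure_sqrt`). The integral over the unit sphere
  of a `d`-dimensional space of the length of the projection to an `m`-dimensional subspace
  depends on `d` and `m` only. It is computed by integrating the length of the projection against
  the Gaussian `exp (-‖x‖²)`, in polar coordinates and by Fubini's theorem. With `d = q - p` and
  `m = k - p` this is the constant of the theorem up to the factor `2 ^ (p / 2)`.
-/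

noncomputable section

open MeasureTheory Module
open scoped NNReal ENNReal InnerProductSpace

/-! ### Comparison of Hausdorff and Lebesgue measure -/

theorem LipschitzOnWith.euclideanHausdorffMeasure_image_le {X Y : Type*} [EMetricSpace X]
    [EMetricSpace Y] [MeasurableSpace X] [BorelSpace X] [MeasurableSpace Y] [BorelSpace Y]
    {K : ℝ≥0} {f : X → Y} {s : Set X} (h : LipschitzOnWith K f s) (d : ℕ) :
    μHE[d] (f '' s) ≤ (K : ℝ≥0∞) ^ d * μHE[d] s := by
  have := h.hausdorffMeasure_image_le (d := (d : ℝ)) (by positivity)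
  rw [Measure.euclideanHausdorffMeasure_def, Measure.euclideanHausdorffMeasure_def,
    Measure.smul_apply, Measure.smul_apply, ENNReal.smul_def, ENNReal.smul_def, smul_eq_mul,
    smul_eq_mul, mul_left_comm]
  gcongr
  simpa using this

/-- If `L ∘ π` distorts distances on `A` by a factor at most `κ`, then up to `κ ^ D` the
`D`-dimensional Hausdorff measure of `A` is the Lebesgue measure of `π '' A`, scaled by the
Jacobian of the linear map `L`. No regularity of `A` is needed. -/
theorem euclideanHausdorffMeasure_comparison {X V : Type*}
    [NormedAddCommGroup X] [InnerProductSpace ℝ X] [MeasurableSpace X] [BorelSpace X]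
    [NormedAddCommGroup V] [InnerProductSpace ℝ V] [FiniteDimensional ℝ V]
    [MeasurableSpace V] [BorelSpace V]
    {A : Set X} {π : X → V} (L : V →ₗ[ℝ] X) {κ : ℝ≥0} {D : ℕ} (hD : finrank ℝ V = D)
    (h₁ : ∀ x ∈ A, ∀ y ∈ A, ‖L (π x - π y)‖ ≤ κ * ‖x - y‖)
    (h₂ : ∀ x ∈ A, ∀ y ∈ A, ‖x - y‖ ≤ κ * ‖L (π x - π y)‖) :
    ENNReal.ofReal L.normDet * volume (π '' A) ≤ κ ^ D * μHE[D] A ∧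
      μHE[D] A ≤ κ ^ D * (ENNReal.ofReal L.normDet * volume (π '' A)) := by
  subst hD
  rw [← LinearMap.euclideanHausdorffMeasure_image_eq_normDet_mul_volume, Set.image_image]
  constructor
  · refine LipschitzOnWith.euclideanHausdorffMeasure_image_le ?_ _
    refine LipschitzOnWith.of_dist_le_mul fun x hx y hy => ?_
    rw [dist_eq_norm, dist_eq_norm, ← map_sub]
    exact h₁ x hx y hy
  · have hinj : Set.InjOn (fun x => L (π x)) A := by
      intro x hx y hy hxy
      have := h₂ x hx y hy
      rw [map_sub, sub_eq_zero.2 hxy, norm_zero, mul_zero] at this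
      exact sub_eq_zero.1 (norm_le_zero_iff.1 this)
    rcases A.eq_empty_or_nonempty with rfl | ⟨a, ha⟩
    · simp
    have : Nonempty X := ⟨a⟩
    have himg : Function.invFunOn (fun x => L (π x)) A '' ((fun x => L (π x)) '' A) = A :=
      hinj.invFunOn_image Set.Subset.rfl
    conv_lhs => rw [← himg]
    refine LipschitzOnWith.euclideanHausdorffMeasure_image_le ?_ _
    refine LipschitzOnWith.of_dist_le_mul ?_
    rintro _ ⟨x, hx, rfl⟩ _ ⟨y, hy, rfl⟩
    have ex : Function.invFunOn (fun x => L (π x)) A (L (π x)) = x :=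
      hinj.leftInvOn_invFunOn hx
    have ey : Function.invFunOn (fun x => L (π x)) A (L (π y)) = y :=
      hinj.leftInvOn_invFunOn hy
    simp only [ex, ey]
    rw [dist_eq_norm, dist_eq_norm, ← map_sub]
    exact h₂ x hx y hy

/-- A measure inequality may be checked locally, up to factors arbitrarily close to one. -/
theorem measure_restrict_le_of_locally_le {X : Type*} [TopologicalSpace X]
    [SecondCountableTopology X] [MeasurableSpace X] [OpensMeasurableSpace X]
    {μ₁ μ₂ : Measure X} {S : Set X} (hS : MeasurableSet S)
    (h : ∀ η : ℝ≥0, 1 < η → ∀ x ∈ S, ∃ N ∈ nhds x, ∀ A, MeasurableSet A → A ⊆ N ∩ S →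
      μ₁ A ≤ η * μ₂ A) :
    μ₁.restrict S ≤ μ₂.restrict S := by
  have key : ∀ η : ℝ≥0, 1 < η → ∀ A, MeasurableSet A → A ⊆ S → μ₁ A ≤ η * μ₂ A := by
    intro η hη A hA hAS
    choose! N hN hN' using h η hη
    obtain ⟨t, htS, htc, hcov⟩ := TopologicalSpace.countable_cover_nhdsWithin
      (f := fun x => interior (N x)) (s := S)
      (fun x hx => mem_nhdsWithin_of_mem_nhds (interior_mem_nhds.2 (hN x hx)))
    rcases t.eq_empty_or_nonempty with rfl | hne
    · have : A = ∅ := by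
        apply Set.eq_empty_of_subset_empty
        exact hAS.trans (by simpa using hcov)
      simp [this]
    obtain ⟨e, rfl⟩ := htc.exists_eq_range hne
    let B : ℕ → Set X := fun n => A ∩ disjointed (fun n => interior (N (e n))) n
    have hB : ∀ n, MeasurableSet (B n) := fun n =>
      hA.inter (MeasurableSet.disjointed (fun n => isOpen_interior.measurableSet) n)
    have hdis : Pairwise (Function.onFun Disjoint B) := fun i j hij =>
      ((disjoint_disjointed (fun n => interior (N (e n)))) hij).mono
        Set.inter_subset_right Set.inter_subset_right
    have hU : A = ⋃ n, B n := by
      rw [← Set.inter_iUnion, iUnion_disjointed]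
      refine (Set.inter_eq_left.2 (hAS.trans ?_)).symm
      simpa [Set.biUnion_range] using hcov
    rw [hU, measure_iUnion hdis hB, measure_iUnion hdis hB, ← ENNReal.tsum_mul_left]
    refine ENNReal.tsum_le_tsum fun n => hN' (e n) (htS ⟨n, rfl⟩) _ (hB n) ?_
    exact fun x hx => ⟨interior_subset (disjointed_subset (fun n => interior (N (e n))) n hx.2),
      hAS hx.1⟩
  refine Measure.le_iff.2 fun A hA => ?_
  rw [Measure.restrict_apply hA, Measure.restrict_apply hA]
  have h' := fun η hη => key η hη _ (hA.inter hS) Set.inter_subset_right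
  have hlim : Filter.Tendsto (fun η : ℝ≥0 => (η : ℝ≥0∞) * μ₂ (A ∩ S)) (nhdsWithin 1 (Set.Ioi 1))
      (nhds (((1 : ℝ≥0) : ℝ≥0∞) * μ₂ (A ∩ S))) := by
    refine ENNReal.Tendsto.mul_const ?_ (Or.inl (by simp))
    exact (ENNReal.continuous_coe.tendsto 1).mono_left nhdsWithin_le_nhds
  have := ge_of_tendsto hlim (Filter.eventually_of_mem self_mem_nhdsWithin fun η hη => h' η hη)
  simpa using this

/-! ### Polar coordinates -/

/-- The surface measure of the unit sphere of `W`, as a measure on `W`. -/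
def sphereMeasure (W : Type*) [NormedAddCommGroup W] [InnerProductSpace ℝ W]
    [FiniteDimensional ℝ W] [MeasurableSpace W] [BorelSpace W] : Measure W :=
  (volume : Measure W).toSphere.map Subtype.val

section Polar
variable {W : Type*} [NormedAddCommGroup W] [InnerProductSpace ℝ W]
    [FiniteDimensional ℝ W] [MeasurableSpace W] [BorelSpace W]

instance : IsFiniteMeasure (sphereMeasure W) := by
  unfold sphereMeasure; infer_instance

theorem ae_sphereMeasure_norm : ∀ᵐ v ∂(sphereMeasure W), ‖v‖ = 1 := by
  rw [sphereMeasure, ae_map_iff (by fun_prop) (by measurability)]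
  exact Filter.Eventually.of_forall fun v => by simp

/-- Integration in polar coordinates of a product of a function of the direction and a function of
the norm. -/
theorem lintegral_polar [Nontrivial W] {g : W → ℝ≥0∞} (hg : Measurable g) {h : ℝ → ℝ≥0∞}
    (hh : Measurable h) :
    ∫⁻ x : W, g (‖x‖⁻¹ • x) * h ‖x‖ =
      (∫⁻ v, g v ∂(sphereMeasure W)) *
        ∫⁻ r in Set.Ioi (0 : ℝ), ENNReal.ofReal (r ^ (finrank ℝ W - 1)) * h r := by
  have hmp := Measure.measurePreserving_homeomorphUnitSphereProd (volume : Measure W)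
  have h1 : ∫⁻ x : W, g (‖x‖⁻¹ • x) * h ‖x‖ =
      ∫⁻ x : ({0}ᶜ : Set W), g (‖(x : W)‖⁻¹ • (x : W)) * h ‖(x : W)‖
        ∂((volume : Measure W).comap (↑)) := by
    rw [lintegral_subtype_comap (measurableSet_singleton _).compl
      (f := fun x : W => g (‖x‖⁻¹ • x) * h ‖x‖), restrict_compl_singleton]
  have h2 : ∫⁻ x : ({0}ᶜ : Set W), g (‖(x : W)‖⁻¹ • (x : W)) * h ‖(x : W)‖
        ∂((volume : Measure W).comap (↑)) =
      ∫⁻ z, g (z.1 : W) * h (z.2 : ℝ) ∂((volume : Measure W).toSphere.prod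
        (Measure.volumeIoiPow (finrank ℝ W - 1))) := by
    rw [← hmp.map_eq, lintegral_map (by fun_prop)
      (homeomorphUnitSphereProd W).measurable]
    simp only [homeomorphUnitSphereProd_apply_fst_coe, homeomorphUnitSphereProd_apply_snd_coe]
  rw [h1, h2, lintegral_prod_mul (f := fun v : Metric.sphere (0 : W) 1 => g v)
    (g := fun r : Set.Ioi (0 : ℝ) => h r) (by fun_prop) (by fun_prop), sphereMeasure,
    lintegral_map hg (by fun_prop), Measure.volumeIoiPow,
    lintegral_withDensity_eq_lintegral_mul _ (by fun_prop) (by fun_prop)]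
  congr 1
  rw [← lintegral_subtype_comap measurableSet_Ioi]
  rfl

end Polar

/-! ### Orthonormal frames and their tangent spaces -/

/-- The `p`-fold power of `E` with its Euclidean metric. -/
abbrev Tuple (p : ℕ) (E : Type*) : Type _ := PiLp 2 (fun _ : Fin p => E)

section Frames
variable {E : Type*} {p : ℕ}

/-- Append a vector to a tuple. -/
def Tuple.snoc (u : Tuple p E) (v : E) : Tuple (p + 1) E :=
  WithLp.toLp 2 (Fin.snoc (α := fun _ => E) u.ofLp v)

/-- Drop the last vector of a tuple. -/
def Tuple.init (w : Tuple (p + 1) E) : Tuple p E :=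
  WithLp.toLp 2 fun i => w i.castSucc

/-- The last vector of a tuple. -/
def Tuple.last (w : Tuple (p + 1) E) : E := w (Fin.last p)

namespace Tuple

@[simp] theorem snoc_castSucc (u : Tuple p E) (v : E) (i : Fin p) :
    Tuple.snoc u v i.castSucc = u i := by simp [Tuple.snoc]

@[simp] theorem snoc_last (u : Tuple p E) (v : E) :
    Tuple.snoc u v (Fin.last p) = v := by simp [Tuple.snoc]

@[simp] theorem init_apply (w : Tuple (p + 1) E) (i : Fin p) : w.init i = w i.castSucc := rfl

theorem last_eq (w : Tuple (p + 1) E) : w.last = w (Fin.last p) := rfl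

@[simp] theorem init_snoc (u : Tuple p E) (v : E) : (Tuple.snoc u v).init = u := by
  ext i; simp

@[simp] theorem last_snoc (u : Tuple p E) (v : E) : (Tuple.snoc u v).last = v := by
  simp [last_eq]

@[simp] theorem snoc_init_last (w : Tuple (p + 1) E) : Tuple.snoc w.init w.last = w := by
  ext i
  refine Fin.lastCases ?_ (fun i => ?_) i <;> simp [last_eq]

theorem snoc_inj {u u' : Tuple p E} {v v' : E} :
    Tuple.snoc u v = Tuple.snoc u' v' ↔ u = u' ∧ v = v' := by
  refine ⟨fun h => ⟨?_, ?_⟩, fun h => by rw [h.1, h.2]⟩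
  · simpa using congrArg Tuple.init h
  · simpa using congrArg Tuple.last h

variable [NormedAddCommGroup E]

theorem init_sub (w w' : Tuple (p + 1) E) : (w - w').init = w.init - w'.init := rfl

theorem last_sub (w w' : Tuple (p + 1) E) : (w - w').last = w.last - w'.last := rfl

theorem norm_last_le (w : Tuple (p + 1) E) : ‖w.last‖ ≤ ‖w‖ := PiLp.norm_apply_le w _

theorem continuous_snoc : Continuous fun z : Tuple p E × E => Tuple.snoc z.1 z.2 := by
  unfold Tuple.snoc
  refine (PiLp.continuous_toLp 2 _).comp (continuous_pi fun i => ?_)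
  refine Fin.lastCases ?_ (fun i => ?_) i
  · simpa using continuous_snd
  · simp only [Fin.snoc_castSucc]
    fun_prop

theorem continuous_init : Continuous (Tuple.init : Tuple (p + 1) E → Tuple p E) := by
  unfold Tuple.init
  fun_prop

theorem continuous_last : Continuous (Tuple.last : Tuple (p + 1) E → E) := by
  unfold Tuple.last
  fun_prop

variable [InnerProductSpace ℝ E]

theorem inner_eq (w w' : Tuple (p + 1) E) :
    ⟪w, w'⟫_ℝ = ⟪w.init, w'.init⟫_ℝ + ⟪w.last, w'.last⟫_ℝ := by
  simp [PiLp.inner_apply, Fin.sum_univ_castSucc, last_eq]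

theorem norm_sq_eq (w : Tuple (p + 1) E) : ‖w‖ ^ 2 = ‖w.init‖ ^ 2 + ‖w.last‖ ^ 2 := by
  simp only [← real_inner_self_eq_norm_sq, inner_eq]

theorem norm_init_le (w : Tuple (p + 1) E) : ‖w.init‖ ≤ ‖w‖ := by
  have := norm_sq_eq w
  exact le_of_sq_le_sq (by nlinarith [sq_nonneg ‖w.last‖]) (norm_nonneg _)

theorem norm_le (w : Tuple (p + 1) E) : ‖w‖ ≤ ‖w.init‖ + ‖w.last‖ := by
  have := norm_sq_eq w
  refine le_of_sq_le_sq ?_ (by positivity)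
  nlinarith [mul_nonneg (norm_nonneg w.init) (norm_nonneg w.last)]

end Tuple

variable [NormedAddCommGroup E] [InnerProductSpace ℝ E]

/-- The orthonormal `p`-frames of `E`. -/
def frameSet (p : ℕ) (E : Type*) [NormedAddCommGroup E] [InnerProductSpace ℝ E] :
    Set (Tuple p E) :=
  {u | Orthonormal ℝ u}

/-- The orthogonal complement of the span of a tuple. -/
def perp (u : Tuple p E) : Submodule ℝ E := (Submodule.span ℝ (Set.range u))ᗮ

theorem mem_perp {u : Tuple p E} {x : E} : x ∈ perp u ↔ ∀ i, ⟪u i, x⟫_ℝ = 0 := by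
  rw [perp, Submodule.mem_orthogonal]
  constructor
  · exact fun h i => h _ (Submodule.subset_span ⟨i, rfl⟩)
  · intro h y hy
    induction hy using Submodule.span_induction with
    | mem y hy => obtain ⟨i, rfl⟩ := hy; exact h i
    | zero => simp
    | add y z _ _ hy hz => rw [inner_add_left, hy, hz, add_zero]
    | smul c y _ hy => rw [inner_smul_left, hy, mul_zero]

theorem snoc_mem_frameSet {u : Tuple p E} {v : E} :
    Tuple.snoc u v ∈ frameSet (p + 1) E ↔ u ∈ frameSet p E ∧ v ∈ perp u ∧ ‖v‖ = 1 := by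
  simp only [frameSet, Set.mem_ofPred_eq, mem_perp]
  constructor
  · intro h
    refine ⟨?_, fun i => ?_, ?_⟩
    · have := h.comp Fin.castSucc (Fin.castSucc_injective p)
      convert this using 1
      ext i; simp
    · have := h.2 (i := i.castSucc) (j := Fin.last p) (Fin.castSucc_lt_last i).ne
      simpa using this
    · simpa using h.1 (Fin.last p)
  · rintro ⟨hu, hv, hv1⟩
    refine ⟨fun i => ?_, fun i j => ?_⟩
    · refine Fin.lastCases ?_ (fun i => ?_) i
      · simpa using hv1
      · simpa using hu.1 i
    · refine Fin.lastCases ?_ (fun i => ?_) i <;> refine Fin.lastCases ?_ (fun j => ?_) j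
      · intro h; exact absurd rfl h
      · intro _; rw [Tuple.snoc_last, Tuple.snoc_castSucc, real_inner_comm]; exact hv j
      · intro _; simpa using hv i
      · intro h; simpa using hu.2 (fun h' => h (by rw [h']))

theorem mem_frameSet_succ {w : Tuple (p + 1) E} :
    w ∈ frameSet (p + 1) E ↔ w.init ∈ frameSet p E ∧ w.last ∈ perp w.init ∧ ‖w.last‖ = 1 := by
  conv_lhs => rw [← w.snoc_init_last]
  exact snoc_mem_frameSet

theorem mem_perp_snoc {u : Tuple p E} {v x : E} :
    x ∈ perp (Tuple.snoc u v) ↔ x ∈ perp u ∧ ⟪v, x⟫_ℝ = 0 := by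
  simp only [mem_perp]
  constructor
  · exact fun h => ⟨fun i => by simpa using h i.castSucc, by simpa using h (Fin.last p)⟩
  · rintro ⟨h, h'⟩ i
    refine Fin.lastCases ?_ (fun i => ?_) i
    · simpa using h'
    · simpa using h i

theorem isClosed_frameSet : IsClosed (frameSet p E) := by
  have : frameSet p E = ⋂ i, ⋂ j, {u : Tuple p E | ⟪u i, u j⟫_ℝ = if i = j then 1 else 0} := by
    ext u
    simp [frameSet, orthonormal_iff_ite]
  rw [this]
  exact isClosed_iInter fun i => isClosed_iInter fun j =>
    isClosed_eq (by fun_prop) continuous_const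

theorem isCompact_frameSet [FiniteDimensional ℝ E] : IsCompact (frameSet p E) := by
  refine Metric.isCompact_of_isClosed_isBounded isClosed_frameSet ?_
  refine (Metric.isBounded_closedBall (x := (0 : Tuple p E)) (r := √p)).subset fun u hu => ?_
  rw [mem_closedBall_zero_iff, PiLp.norm_eq_of_L2]
  simp [show ∀ i, ‖u i‖ = 1 from hu.1]

theorem starProjection_perp [FiniteDimensional ℝ E] {u : Tuple p E} (hu : u ∈ frameSet p E)
    (x : E) : (perp u).starProjection x = x - ∑ i, ⟪u i, x⟫_ℝ • u i := by
  refine Submodule.eq_starProjection_of_mem_orthogonal (K := perp u) ?_ ?_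
  · rw [mem_perp]
    intro i
    rw [inner_sub_right, Orthonormal.inner_right_fintype hu, sub_self]
  · rw [sub_sub_cancel, perp]
    exact Submodule.le_orthogonal_orthogonal _ (Submodule.sum_mem _ fun i _ =>
      Submodule.smul_mem _ _ (Submodule.subset_span ⟨i, rfl⟩))

theorem finrank_perp [FiniteDimensional ℝ E] {u : Tuple p E} (hu : u ∈ frameSet p E) :
    p + finrank ℝ (perp u) = finrank ℝ E := by
  rw [← Submodule.finrank_add_finrank_orthogonal (Submodule.span ℝ (Set.range u)),
    finrank_span_eq_card (Orthonormal.linearIndependent hu), Fintype.card_fin]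
  rfl

/-- The tangent space at `u` of the manifold of orthonormal frames. -/
def frameTangent (u : Tuple p E) : Submodule ℝ (Tuple p E) where
  carrier := {ξ | ∀ i j, ⟪ξ i, u j⟫_ℝ + ⟪u i, ξ j⟫_ℝ = 0}
  zero_mem' := by simp
  add_mem' {a b} ha hb i j := by
    have h₁ := ha i j
    have h₂ := hb i j
    simp only [PiLp.add_apply, inner_add_left, inner_add_right]
    linarith
  smul_mem' c a ha i j := by
    have h₁ := ha i j
    simp only [PiLp.smul_apply, inner_smul_left, inner_smul_right]
    simp [← mul_add, h₁]

theorem mem_frameTangent {u ξ : Tuple p E} :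
    ξ ∈ frameTangent u ↔ ∀ i j, ⟪ξ i, u j⟫_ℝ + ⟪u i, ξ j⟫_ℝ = 0 := Iff.rfl

/-- The tangent space at the frame `snoc u v`, parametrized by a tangent vector `ξ` at `u` and a
vector `η` tangent to the unit sphere of `perp u` at `v`. Since `v` must remain orthogonal to `u`,
the last vector moves by `-∑ ⟪ξ i, v⟫ • u i` in addition to `η`. -/
def frameLift (u : Tuple p E) (v : E) :
    WithLp 2 (frameTangent u × perp (Tuple.snoc u v)) →ₗ[ℝ] Tuple (p + 1) E where
  toFun z := Tuple.snoc (z.fst : Tuple p E)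
    ((z.snd : E) - ∑ i, ⟪(z.fst : Tuple p E) i, v⟫_ℝ • u i)
  map_add' z z' := by
    ext i
    refine Fin.lastCases ?_ (fun i => ?_) i
    · simp [inner_add_left, add_smul, Finset.sum_add_distrib]
      abel
    · simp
  map_smul' c z := by
    ext i
    refine Fin.lastCases ?_ (fun i => ?_) i
    · simp [inner_smul_left, smul_sub, Finset.smul_sum, smul_smul]
    · simp

theorem frameLift_apply (u : Tuple p E) (v : E)
    (z : WithLp 2 (frameTangent u × perp (Tuple.snoc u v))) :
    frameLift u v z = Tuple.snoc (z.fst : Tuple p E)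
      ((z.snd : E) - ∑ i, ⟪(z.fst : Tuple p E) i, v⟫_ℝ • u i) := rfl

theorem frameLift_injective (u : Tuple p E) (v : E) : Function.Injective (frameLift u v) := by
  rw [injective_iff_map_eq_zero]
  intro z hz
  rw [frameLift_apply] at hz
  have h0 : (0 : Tuple (p + 1) E) = Tuple.snoc 0 0 := by
    ext i
    refine Fin.lastCases ?_ (fun i => ?_) i <;> simp
  rw [h0, Tuple.snoc_inj] at hz
  obtain ⟨h1, h2⟩ := hz
  have hf : z.fst = 0 := Subtype.ext h1
  rw [h1] at h2
  have hs : z.snd = 0 := Subtype.ext (by simpa using h2)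
  exact (WithLp.ofLp_injective 2) (Prod.ext hf hs)

theorem range_frameLift {u : Tuple p E} {v : E} (hw : Tuple.snoc u v ∈ frameSet (p + 1) E) :
    LinearMap.range (frameLift u v) = frameTangent (Tuple.snoc u v) := by
  obtain ⟨hu, hv, hv1⟩ := snoc_mem_frameSet.1 hw
  rw [mem_perp] at hv
  have hv' : ∀ i, ⟪v, u i⟫_ℝ = 0 := fun i => by rw [real_inner_comm, hv]
  ext d
  constructor
  · rintro ⟨z, rfl⟩
    have hz := mem_perp_snoc.1 z.snd.2
    have hz1 := mem_perp.1 hz.1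
    rw [frameLift_apply, mem_frameTangent]
    have hlast : ∀ j, ⟪(z.snd : E) - ∑ i, ⟪(z.fst : Tuple p E) i, v⟫_ℝ • u i, u j⟫_ℝ =
        - ⟪(z.fst : Tuple p E) j, v⟫_ℝ := by
      intro j
      rw [inner_sub_left, Orthonormal.inner_left_fintype hu, real_inner_comm, hz1]
      simp
    have hself : ⟪(z.snd : E) - ∑ i, ⟪(z.fst : Tuple p E) i, v⟫_ℝ • u i, v⟫_ℝ = 0 := by
      rw [inner_sub_left, real_inner_comm, hz.2, sum_inner]
      simp [inner_smul_left, hv]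
    intro i j
    refine Fin.lastCases ?_ (fun i => ?_) i <;> refine Fin.lastCases ?_ (fun j => ?_) j
    · simp only [Tuple.snoc_last]
      rw [hself, real_inner_comm, hself, add_zero]
    · simp only [Tuple.snoc_last, Tuple.snoc_castSucc]
      rw [hlast, real_inner_comm v]
      ring
    · simp only [Tuple.snoc_last, Tuple.snoc_castSucc]
      rw [real_inner_comm _ (u i), hlast]
      ring
    · simp only [Tuple.snoc_castSucc]
      exact z.fst.2 i j
  · intro hd
    have hd' := mem_frameTangent.1 hd
    have h1 : d.init ∈ frameTangent u := fun i j => by simpa using hd' i.castSucc j.castSucc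
    have h2 : d.last + ∑ i, ⟪d.init i, v⟫_ℝ • u i ∈ perp (Tuple.snoc u v) := by
      rw [mem_perp_snoc, mem_perp]
      refine ⟨fun j => ?_, ?_⟩
      · rw [inner_add_right, Orthonormal.inner_right_fintype hu]
        have := hd' j.castSucc (Fin.last p)
        simp only [Tuple.snoc_last, Tuple.snoc_castSucc] at this
        rw [Tuple.init_apply, Tuple.last_eq]
        linarith
      · have := hd' (Fin.last p) (Fin.last p)
        simp only [Tuple.snoc_last] at this
        rw [real_inner_comm] at this
        rw [inner_add_right, inner_sum, Tuple.last_eq]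
        simp only [inner_smul_right, hv', mul_zero, Finset.sum_const_zero]
        linarith
    refine ⟨WithLp.toLp 2 (⟨_, h1⟩, ⟨_, h2⟩), ?_⟩
    rw [frameLift_apply]
    conv_rhs => rw [← d.snoc_init_last]
    simp

theorem finrank_frameTangent [FiniteDimensional ℝ E] :
    ∀ {p : ℕ} {u : Tuple p E}, u ∈ frameSet p E →
      2 * finrank ℝ (frameTangent u) + p * (p + 1) = 2 * p * finrank ℝ E := by
  intro p
  induction p with
  | zero =>
    intro u _
    have : finrank ℝ (frameTangent u) = 0 := by
      have := Submodule.finrank_le (frameTangent u)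
      have h2 : finrank ℝ (Tuple 0 E) = 0 := finrank_zero_of_subsingleton
      omega
    simp [this]
  | succ p ih =>
    intro w hw
    rw [← w.snoc_init_last] at hw ⊢
    have hu := snoc_mem_frameSet.1 hw
    have h1 : finrank ℝ (frameTangent (Tuple.snoc w.init w.last)) =
        finrank ℝ (frameTangent w.init) + finrank ℝ (perp (Tuple.snoc w.init w.last)) := by
      rw [← range_frameLift hw,
        LinearMap.finrank_range_of_inj (frameLift_injective w.init w.last),
        (WithLp.linearEquiv 2 ℝ
          (frameTangent w.init × perp (Tuple.snoc w.init w.last))).finrank_eq, finrank_prod]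
    have h2 := finrank_perp hw
    have h3 := ih hu.1
    rw [h1]
    nlinarith

/-- The dimension of the manifold of orthonormal `p`-frames in dimension `q`. -/
theorem finrank_frameTangent_eq [FiniteDimensional ℝ E] {u : Tuple p E} (hu : u ∈ frameSet p E) :
    finrank ℝ (frameTangent u) = p * (2 * finrank ℝ E - p - 1) / 2 := by
  have h := finrank_frameTangent hu
  have h2 := finrank_perp hu
  obtain ⟨m, hm⟩ : ∃ m, finrank ℝ E = p + m := ⟨_, h2.symm⟩
  rw [hm] at h ⊢
  rcases Nat.eq_zero_or_pos p with rfl | hp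
  · simpa using h
  have : 2 * (p + m) - p - 1 + (p + 1) = 2 * (p + m) := by omega
  have h3 : p * (2 * (p + m) - p - 1) + p * (p + 1) = 2 * p * (p + m) := by
    rw [← mul_add, this]; ring
  omega

/-- The Jacobian of a linear map that stretches `m` orthonormal directions by `√2` and is isometric
on their complement. -/
theorem normDet_sq_of_inner {V X : Type*} [NormedAddCommGroup V] [InnerProductSpace ℝ V]
    [FiniteDimensional ℝ V] [NormedAddCommGroup X] [InnerProductSpace ℝ X] {m : ℕ}
    (L : V →ₗ[ℝ] X) {a : Fin m → V} (ha : Orthonormal ℝ a)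
    (h : ∀ x y, ⟪L x, L y⟫_ℝ = ⟪x, y⟫_ℝ + ∑ i, ⟪a i, x⟫_ℝ * ⟪a i, y⟫_ℝ) :
    L.normDet ^ 2 = 2 ^ m := by
  classical
  let e := stdOrthonormalBasis ℝ V
  have h1 := L.normDet_sq_eq_det_gram e
  simp only [RCLike.ofReal_real_eq_id, id] at h1
  rw [h1]
  let M : Matrix (Fin m) (Fin (finrank ℝ V)) ℝ := Matrix.of fun i j => ⟪a i, e j⟫_ℝ
  have h2 : Matrix.gram ℝ (fun j => L (e j)) = 1 + M.transpose * M := by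
    ext j k
    rw [Matrix.gram_apply, h, Matrix.add_apply, Matrix.mul_apply, Matrix.one_apply,
      orthonormal_iff_ite.1 e.orthonormal]
    rfl
  have h3 : M * M.transpose = 1 := by
    ext i k
    rw [Matrix.mul_apply, Matrix.one_apply, ← orthonormal_iff_ite.1 ha,
      ← e.sum_inner_mul_inner (a i) (a k)]
    refine Finset.sum_congr rfl fun j _ => ?_
    simp [M, real_inner_comm]
  rw [h2, Matrix.det_one_add_mul_comm, h3, ← two_smul ℝ (1 : Matrix (Fin m) (Fin m) ℝ),
    Matrix.det_smul, Matrix.det_one]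
  simp

theorem normDet_frameLift [FiniteDimensional ℝ E] {u : Tuple p E} {v : E}
    (hw : Tuple.snoc u v ∈ frameSet (p + 1) E) :
    (frameLift u v).normDet = 2 ^ ((p : ℝ) / 2) := by
  classical
  obtain ⟨hu, hv, hv1⟩ := snoc_mem_frameSet.1 hw
  rw [mem_perp] at hv
  have hv' : ∀ i, ⟪v, u i⟫_ℝ = 0 := fun i => by rw [real_inner_comm, hv]
  have hmem : ∀ i, PiLp.single 2 i v ∈ frameTangent u := by
    intro i j k
    have h2 : ∀ l m, ⟪(PiLp.single 2 i v : Tuple p E) l, u m⟫_ℝ = 0 := by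
      intro l m
      by_cases hkl : l = i
      · subst hkl; simp [hv']
      · simp [hkl]
    rw [h2, real_inner_comm, h2, add_zero]
  let a : Fin p → WithLp 2 (frameTangent u × perp (Tuple.snoc u v)) := fun i =>
    WithLp.toLp 2 (⟨PiLp.single 2 i v, hmem i⟩, 0)
  have hinner : ∀ i x, ⟪a i, x⟫_ℝ = ⟪(x.fst : Tuple p E) i, v⟫_ℝ := by
    intro i x
    simp [a, WithLp.prod_inner_apply, PiLp.inner_apply, PiLp.single_apply, real_inner_comm]
    rw [Finset.sum_eq_single i] <;> simp +contextual
  have ha : Orthonormal ℝ a := by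
    rw [orthonormal_iff_ite]
    intro i j
    rw [hinner]
    by_cases hij : i = j
    · subst hij; simp [a, hv1]
    · simp [a, hij]
  have h2 := normDet_sq_of_inner (frameLift u v) ha fun x y => by
    have hx := mem_perp.1 (mem_perp_snoc.1 x.snd.2).1
    have hy := mem_perp.1 (mem_perp_snoc.1 y.snd.2).1
    rw [frameLift_apply, frameLift_apply, Tuple.inner_eq, WithLp.prod_inner_apply]
    simp only [Tuple.init_snoc, Tuple.last_snoc, hinner, Submodule.coe_inner]
    rw [inner_sub_left, inner_sub_right, inner_sub_right, sum_inner, sum_inner, inner_sum]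
    simp only [inner_smul_left, inner_smul_right, hy, Orthonormal.inner_right_fintype hu]
    simp [real_inner_comm, hx]
    ring
  have h3 : ((2 : ℝ) ^ ((p : ℝ) / 2)) ^ 2 = 2 ^ p := by
    rw [← Real.rpow_natCast, ← Real.rpow_mul (by norm_num)]
    simp
  rw [← h3] at h2
  exact (pow_left_inj₀ (LinearMap.normDet_nonneg _) (by positivity) two_ne_zero).1 h2

end Frames

/-! ### Secants of the manifold of frames -/

/-- The bound `1 - κ⁻¹` serves both inequalities, since `2 - κ⁻¹ ≤ κ`. -/
theorem norm_le_of_norm_sub_le {X : Type*} [SeminormedAddCommGroup X] {d e : X} {κ : ℝ}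
    (hκ : 1 ≤ κ) (h : ‖d - e‖ ≤ (1 - κ⁻¹) * ‖d‖) : ‖e‖ ≤ κ * ‖d‖ ∧ ‖d‖ ≤ κ * ‖e‖ := by
  have hκ0 : 0 < κ := by linarith
  have h1 : κ * κ⁻¹ = 1 := mul_inv_cancel₀ hκ0.ne'
  have hinv : 2 - κ⁻¹ ≤ κ := by
    have : 0 ≤ (κ - 1) ^ 2 * κ⁻¹ := by positivity
    have h2 : (κ - 1) ^ 2 * κ⁻¹ = κ - 2 + κ⁻¹ := by field_simp; ring
    linarith
  have ha : ‖e‖ ≤ ‖d‖ + ‖d - e‖ := by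
    have := norm_sub_le d (d - e)
    rwa [sub_sub_cancel] at this
  have hb : ‖d‖ ≤ ‖e‖ + ‖d - e‖ := by
    have := norm_add_le e (d - e)
    rwa [add_sub_cancel] at this
  constructor
  · nlinarith [norm_nonneg d, mul_le_mul_of_nonneg_right hinv (norm_nonneg d)]
  · have h2 : κ⁻¹ * ‖d‖ ≤ ‖e‖ := by linarith
    calc ‖d‖ = κ * (κ⁻¹ * ‖d‖) := by rw [← mul_assoc, h1, one_mul]
      _ ≤ _ := by gcongr

theorem norm_sub_starProjection_le {X : Type*} [NormedAddCommGroup X] [InnerProductSpace ℝ X]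
    (U : Submodule ℝ X) [U.HasOrthogonalProjection] (d : X) {t : X} (ht : t ∈ U) :
    ‖d - U.starProjection d‖ ≤ ‖d - t‖ := by
  rw [Submodule.starProjection_minimal]
  exact ciInf_le (f := fun x : U => ‖d - x‖) ⟨0, by rintro _ ⟨x, rfl⟩; positivity⟩ ⟨t, ht⟩

theorem Tuple.norm_le_of_forall {E : Type*} [NormedAddCommGroup E] {p : ℕ} {c : Tuple p E}
    {r : ℝ} (hr : 0 ≤ r) (h : ∀ i, ‖c i‖ ≤ r) : ‖c‖ ≤ p * r := by
  refine le_of_sq_le_sq ?_ (by positivity)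
  rw [PiLp.norm_sq_eq_of_L2]
  calc ∑ i, ‖c i‖ ^ 2 ≤ ∑ i : Fin p, r ^ 2 := by gcongr with i; exact h i
    _ = p * r ^ 2 := by simp
    _ ≤ (p * r) ^ 2 := by
      rw [mul_pow]
      gcongr
      exact_mod_cast Nat.le_self_pow two_ne_zero p

section Secants
variable {E : Type*} [NormedAddCommGroup E] [InnerProductSpace ℝ E] {p : ℕ} {δ : ℝ}

/-- The linearized orthonormality relations hold up to a small error on secants near `u`: they hold
exactly when `u` is replaced by the midpoint of the secant. -/
theorem abs_inner_add_inner_le {u x y : Tuple p E} (hx : x ∈ frameSet p E) (hy : y ∈ frameSet p E)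
    (hxu : ‖x - u‖ ≤ δ) (hyu : ‖y - u‖ ≤ δ) (i j : Fin p) :
    |⟪(x - y) i, u j⟫_ℝ + ⟪u i, (x - y) j⟫_ℝ| ≤ 2 * δ * ‖x - y‖ := by
  have hδ : 0 ≤ δ := (norm_nonneg _).trans hxu
  have hm : ∀ k, ‖u k - (2⁻¹ : ℝ) • (x k + y k)‖ ≤ δ := by
    intro k
    have e : u k - (2⁻¹ : ℝ) • (x k + y k) =
        (2⁻¹ : ℝ) • -((x - u) k) + (2⁻¹ : ℝ) • -((y - u) k) := by
      simp only [PiLp.sub_apply]; module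
    rw [e]
    refine (norm_add_le _ _).trans ?_
    rw [norm_smul, norm_smul, norm_neg, norm_neg]
    have h1 := (PiLp.norm_apply_le (x - u) k).trans hxu
    have h2 := (PiLp.norm_apply_le (y - u) k).trans hyu
    norm_num
    simp only [PiLp.sub_apply] at h1 h2
    linarith
  have hxx : ⟪x i, x j⟫_ℝ = ⟪y i, y j⟫_ℝ := by
    rw [orthonormal_iff_ite.1 hx, orthonormal_iff_ite.1 hy]
  have key : ⟪(x - y) i, u j⟫_ℝ + ⟪u i, (x - y) j⟫_ℝ =
      ⟪(x - y) i, u j - (2⁻¹ : ℝ) • (x j + y j)⟫_ℝ +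
        ⟪u i - (2⁻¹ : ℝ) • (x i + y i), (x - y) j⟫_ℝ := by
    simp only [PiLp.sub_apply, inner_sub_left, inner_sub_right, inner_add_left, inner_add_right,
      inner_smul_left, inner_smul_right, conj_trivial]
    linear_combination hxx
  rw [key]
  calc _ ≤ ‖(x - y) i‖ * δ + δ * ‖(x - y) j‖ := by
        refine (abs_add_le _ _).trans (add_le_add ?_ ?_)
        · exact (abs_real_inner_le_norm _ _).trans (by gcongr; exact hm j)
        · exact (abs_real_inner_le_norm _ _).trans (by gcongr; exact hm i)
    _ ≤ ‖x - y‖ * δ + δ * ‖x - y‖ := by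
        gcongr <;> exact PiLp.norm_apply_le (x - y) _
    _ = _ := by ring

/-- Secants of the manifold of frames are nearly tangent. -/
theorem norm_sub_starProjection_frameTangent_le [FiniteDimensional ℝ E] {u x y : Tuple p E}
    (hu : u ∈ frameSet p E) (hx : x ∈ frameSet p E) (hy : y ∈ frameSet p E)
    (hxu : ‖x - u‖ ≤ δ) (hyu : ‖y - u‖ ≤ δ) :
    ‖(x - y) - (frameTangent u).starProjection (x - y)‖ ≤ p ^ 2 * δ * ‖x - y‖ := by
  have hδ : 0 ≤ δ := (norm_nonneg _).trans hxu
  have hS := abs_inner_add_inner_le hx hy hxu hyu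
  obtain ⟨d, hd⟩ : ∃ d, x - y = d := ⟨_, rfl⟩
  rw [hd] at hS ⊢
  -- subtracting half of the symmetric part of `⟪d i, u j⟫` from `d` gives a tangent vector
  let S : Fin p → Fin p → ℝ := fun i j => ⟪d i, u j⟫_ℝ + ⟪u i, d j⟫_ℝ
  let c : Tuple p E := WithLp.toLp 2 fun i => (2⁻¹ : ℝ) • ∑ j, S i j • u j
  have ht : d - c ∈ frameTangent u := by
    intro i j
    have h1 : ⟪c i, u j⟫_ℝ = 2⁻¹ * S i j := by
      simp only [c, inner_smul_left, conj_trivial]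
      rw [Orthonormal.inner_left_fintype hu]
      simp
    have h2 : ⟪u i, c j⟫_ℝ = 2⁻¹ * S j i := by
      simp only [c, inner_smul_right]
      rw [Orthonormal.inner_right_fintype hu]
    have h3 : S j i = S i j := by
      simp only [S]
      rw [add_comm, real_inner_comm, real_inner_comm (d j)]
    rw [PiLp.sub_apply, PiLp.sub_apply, inner_sub_left, inner_sub_right, h1, h2, h3]
    simp only [S]
    ring
  refine (norm_sub_starProjection_le _ d ht).trans ?_
  rw [sub_sub_cancel]
  calc ‖c‖ ≤ p * (p * δ * ‖d‖) := by
        refine Tuple.norm_le_of_forall (by positivity) fun i => ?_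
        have : ‖∑ j, S i j • u j‖ ≤ ∑ _j : Fin p, 2 * δ * ‖d‖ := by
          refine norm_sum_le_of_le _ fun j _ => ?_
          rw [norm_smul, hu.1 j, mul_one]
          exact hS i j
        simp only [c, norm_smul]
        simp only [Finset.sum_const, Finset.card_univ, Fintype.card_fin, nsmul_eq_mul] at this
        norm_num
        linarith
    _ = _ := by ring

theorem sub_starProjection_perp_snoc [FiniteDimensional ℝ E] {u : Tuple p E} {v : E}
    (hw : Tuple.snoc u v ∈ frameSet (p + 1) E) (d : E) :
    d - (perp (Tuple.snoc u v)).starProjection d =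
      ∑ i, ⟪u i, d⟫_ℝ • u i + ⟪v, d⟫_ℝ • v := by
  rw [starProjection_perp hw, sub_sub_cancel, Fin.sum_univ_castSucc]
  simp

/-- Secants of the unit sphere of `perp u'` are nearly tangent to the unit sphere of `perp u`. -/
theorem norm_sub_starProjection_perp_le [FiniteDimensional ℝ E] {u u' : Tuple p E} {v x y : E}
    (hw : Tuple.snoc u v ∈ frameSet (p + 1) E) (hu : ‖u' - u‖ ≤ δ)
    (hx : x ∈ perp u') (hy : y ∈ perp u') (hx1 : ‖x‖ = 1) (hy1 : ‖y‖ = 1)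
    (hxv : ‖x - v‖ ≤ δ) (hyv : ‖y - v‖ ≤ δ) :
    ‖(x - y) - (perp (Tuple.snoc u v)).starProjection (x - y)‖ ≤ (p + 1) * δ * ‖x - y‖ := by
  obtain ⟨hu1, -, hv1⟩ := snoc_mem_frameSet.1 hw
  rw [sub_starProjection_perp_snoc hw]
  have h1 : ∀ i, ‖⟪u i, x - y⟫_ℝ • u i‖ ≤ δ * ‖x - y‖ := by
    intro i
    have h0 : ⟪u' i, x - y⟫_ℝ = 0 := mem_perp.1 (Submodule.sub_mem _ hx hy) i
    have h2 : ⟪u i, x - y⟫_ℝ = - ⟪(u' - u) i, x - y⟫_ℝ := by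
      rw [PiLp.sub_apply, inner_sub_left, h0]; ring
    rw [norm_smul, hu1.1 i, mul_one, h2, norm_neg]
    refine (norm_inner_le_norm _ _).trans ?_
    gcongr
    exact (PiLp.norm_apply_le (u' - u) i).trans hu
  have h2 : ‖⟪v, x - y⟫_ℝ • v‖ ≤ δ * ‖x - y‖ := by
    -- the secant is orthogonal to its midpoint, which is close to `v`
    have h0 : ⟪(2⁻¹ : ℝ) • (x + y), x - y⟫_ℝ = 0 := by
      rw [inner_smul_left, real_inner_add_sub_eq_zero_iff _ _ |>.2 (hx1.trans hy1.symm), mul_zero]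
    have h3 : ⟪v, x - y⟫_ℝ = ⟪v - (2⁻¹ : ℝ) • (x + y), x - y⟫_ℝ := by
      rw [inner_sub_left, h0, sub_zero]
    rw [norm_smul, hv1, mul_one, h3]
    refine (norm_inner_le_norm _ _).trans ?_
    gcongr
    have e : v - (2⁻¹ : ℝ) • (x + y) = (2⁻¹ : ℝ) • -(x - v) + (2⁻¹ : ℝ) • -(y - v) := by module
    rw [e]
    refine (norm_add_le _ _).trans ?_
    rw [norm_smul, norm_smul, norm_neg, norm_neg]
    norm_num
    linarith
  calc _ ≤ ∑ i : Fin p, δ * ‖x - y‖ + δ * ‖x - y‖ :=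
        (norm_add_le _ _).trans (add_le_add (norm_sum_le_of_le _ fun i _ => h1 i) h2)
    _ = _ := by simp; ring

/-- The linear coordinates of a frame near `snoc u v`: the components in the tangent space at `u`
and in the tangent space at `v` of the unit sphere of `perp u`. -/
def frameCoord [FiniteDimensional ℝ E] (u : Tuple p E) (v : E) (w : Tuple (p + 1) E) :
    WithLp 2 (frameTangent u × perp (Tuple.snoc u v)) :=
  WithLp.toLp 2 ((frameTangent u).orthogonalProjectionOnto w.init,
    (perp (Tuple.snoc u v)).orthogonalProjectionOnto w.last)

/-- Secants of the manifold of `(p + 1)`-frames near `snoc u v` are nearly equal to the image under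
`frameLift` of their coordinates. -/
theorem norm_sub_frameLift_frameCoord_le [FiniteDimensional ℝ E] {u : Tuple p E} {v : E}
    {x y : Tuple (p + 1) E} (hw : Tuple.snoc u v ∈ frameSet (p + 1) E)
    (hx : x ∈ frameSet (p + 1) E) (hy : y ∈ frameSet (p + 1) E)
    (hxw : ‖x - Tuple.snoc u v‖ ≤ δ) (hyw : ‖y - Tuple.snoc u v‖ ≤ δ) :
    ‖(x - y) - frameLift u v (frameCoord u v x - frameCoord u v y)‖ ≤
      (p ^ 3 + p ^ 2 + 2 * p + 1) * δ * ‖x - y‖ := by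
  have hδ : 0 ≤ δ := (norm_nonneg _).trans hxw
  obtain ⟨hu, hv, hv1⟩ := snoc_mem_frameSet.1 hw
  have hS := abs_inner_add_inner_le hx hy hxw hyw
  obtain ⟨d, hd⟩ : ∃ d, x - y = d := ⟨_, rfl⟩
  have hdi : x.init - y.init = d.init := by rw [← hd]; rfl
  have hdl : x.last - y.last = d.last := by rw [← hd]; rfl
  obtain ⟨T, hT'⟩ : ∃ T, frameTangent u = T := ⟨_, rfl⟩
  have hxu : ‖x.init - u‖ ≤ δ := by
    simpa [Tuple.init_sub] using (Tuple.norm_init_le _).trans hxw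
  have hyu : ‖y.init - u‖ ≤ δ := by
    simpa [Tuple.init_sub] using (Tuple.norm_init_le _).trans hyw
  have hT : ‖d.init - T.starProjection d.init‖ ≤ p ^ 2 * δ * ‖d‖ := by
    have := norm_sub_starProjection_frameTangent_le hu (mem_frameSet_succ.1 hx).1
      (mem_frameSet_succ.1 hy).1 hxu hyu
    rw [hdi, hT'] at this
    refine this.trans ?_
    gcongr
    exact Tuple.norm_init_le d
  have hcoord : frameLift u v (frameCoord u v x - frameCoord u v y) =
      Tuple.snoc (T.starProjection d.init) ((perp (Tuple.snoc u v)).starProjection d.last -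
        ∑ i, ⟪(T.starProjection d.init) i, v⟫_ℝ • u i) := by
    rw [frameLift_apply]
    have h1 : ((frameCoord u v x - frameCoord u v y).fst : Tuple p E) =
        T.starProjection d.init := by
      rw [← hT', ← hdi, map_sub]; rfl
    have h2 : ((frameCoord u v x - frameCoord u v y).snd : E) =
        (perp (Tuple.snoc u v)).starProjection d.last := by
      rw [← hdl, map_sub]; rfl
    rw [h1, h2]
  rw [hcoord]
  rw [hd] at hS ⊢
  refine (Tuple.norm_le _).trans ?_
  rw [Tuple.init_sub, Tuple.last_sub, Tuple.init_snoc, Tuple.last_snoc]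
  have hlast : d.last - ((perp (Tuple.snoc u v)).starProjection d.last -
      ∑ i, ⟪(T.starProjection d.init) i, v⟫_ℝ • u i) =
      ∑ i, ((⟪d i.castSucc, v⟫_ℝ + ⟪u i, d.last⟫_ℝ) -
        ⟪(d.init - T.starProjection d.init) i, v⟫_ℝ) • u i + ⟪v, d.last⟫_ℝ • v := by
    rw [← sub_add, sub_starProjection_perp_snoc hw, add_right_comm, ← Finset.sum_add_distrib]
    congr 1
    refine Finset.sum_congr rfl fun i _ => ?_
    rw [PiLp.sub_apply, inner_sub_left, Tuple.init_apply]
    module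
  have h1 : ∀ i, ‖((⟪d i.castSucc, v⟫_ℝ + ⟪u i, d.last⟫_ℝ) -
        ⟪(d.init - T.starProjection d.init) i, v⟫_ℝ) • u i‖ ≤ (2 + p ^ 2) * δ * ‖d‖ := by
    intro i
    rw [norm_smul, hu.1 i, mul_one]
    refine (norm_sub_le _ _).trans ?_
    have a1 := hS i.castSucc (Fin.last p)
    simp only [Tuple.snoc_last, Tuple.snoc_castSucc] at a1
    have a2 : ‖⟪(d.init - T.starProjection d.init) i, v⟫_ℝ‖ ≤ p ^ 2 * δ * ‖d‖ := by
      refine (norm_inner_le_norm _ _).trans ?_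
      rw [hv1, mul_one]
      exact (PiLp.norm_apply_le (d.init - T.starProjection d.init) i).trans hT
    rw [Real.norm_eq_abs, Tuple.last_eq]
    linarith
  have h2 : ‖⟪v, d.last⟫_ℝ • v‖ ≤ δ * ‖d‖ := by
    have a1 := hS (Fin.last p) (Fin.last p)
    simp only [Tuple.snoc_last] at a1
    rw [real_inner_comm, ← two_mul, abs_mul, abs_two] at a1
    rw [norm_smul, hv1, mul_one, Real.norm_eq_abs, Tuple.last_eq]
    linarith
  rw [hlast]
  calc _ ≤ p ^ 2 * δ * ‖d‖ + (∑ i : Fin p, (2 + p ^ 2) * δ * ‖d‖ + δ * ‖d‖) :=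
        add_le_add hT ((norm_add_le _ _).trans
          (add_le_add (norm_sum_le_of_le _ fun i _ => h1 i) h2))
    _ = _ := by simp; ring

end Secants

/-! ### Comparison with coordinates on the fibres -/

section Radial
variable {E : Type*} [NormedAddCommGroup E] [InnerProductSpace ℝ E]

/-- Polar coordinates near `v`, linearized. -/
def radialLift (v : E) (W : Submodule ℝ E) (hv : ‖v‖ = 1) (hW : ∀ x ∈ W, ⟪v, x⟫_ℝ = 0) :
    WithLp 2 (ℝ × W) →ₗᵢ[ℝ] E where
  toFun z := z.fst • v + (z.snd : E)
  map_add' z z' := by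
    rw [WithLp.add_fst, WithLp.add_snd, Submodule.coe_add, add_smul]
    abel
  map_smul' c z := by
    rw [WithLp.smul_fst, WithLp.smul_snd, Submodule.coe_smul, smul_eq_mul, mul_smul, smul_add]
    rfl
  norm_map' z := by
    simp only [LinearMap.coe_mk, AddHom.coe_mk]
    rw [← sq_eq_sq₀ (norm_nonneg _) (norm_nonneg _), WithLp.prod_norm_sq_eq_of_L2,
      norm_add_sq_real, inner_smul_left, hW _ z.snd.2, norm_smul, hv]
    simp

/-- A bound on secants of the unit sphere near `v` gives one on secants of a thin shell, in the
coordinates of `radialLift`. -/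
theorem norm_sub_radial_le {x y v w w' : E} {ρ ρ' δ : ℝ} {K : ℝ} (hδ : 0 ≤ δ) (hK : 0 ≤ K)
    (hx1 : ‖x‖ = 1) (hy1 : ‖y‖ = 1) (hxv : ‖x - v‖ ≤ δ)
    (hρ0 : 1 ≤ ρ) (hρ0' : 1 ≤ ρ') (hρ1' : ρ' ≤ 1 + δ)
    (h : ‖(x - y) - (w - w')‖ ≤ K * δ * ‖x - y‖) :
    ‖(ρ • x - ρ' • y) - ((ρ - ρ') • v + (w - w'))‖ ≤ (2 * K + 3) * δ * ‖ρ • x - ρ' • y‖ := by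
  have e : (ρ • x - ρ' • y) - ((ρ - ρ') • v + (w - w')) =
      (ρ - ρ') • (x - v) + (ρ' - 1) • (x - y) + ((x - y) - (w - w')) := by module
  have h1 : |ρ - ρ'| ≤ ‖ρ • x - ρ' • y‖ := by
    have := abs_norm_sub_norm_le (ρ • x) (ρ' • y)
    rwa [norm_smul, norm_smul, hx1, hy1, mul_one, mul_one, Real.norm_of_nonneg (by linarith),
      Real.norm_of_nonneg (by linarith)] at this
  have h2 : ‖x - y‖ ≤ 2 * ‖ρ • x - ρ' • y‖ := by
    have e2 : ρ' • (x - y) = (ρ • x - ρ' • y) - (ρ - ρ') • x := by module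
    have h3 : ‖ρ' • (x - y)‖ ≤ ‖ρ • x - ρ' • y‖ + |ρ - ρ'| := by
      rw [e2]
      refine (norm_sub_le _ _).trans ?_
      rw [norm_smul, hx1, mul_one, Real.norm_eq_abs]
    rw [norm_smul, Real.norm_of_nonneg (by linarith)] at h3
    have : 1 * ‖x - y‖ ≤ ρ' * ‖x - y‖ := by gcongr
    linarith
  rw [e]
  set D := ‖ρ • x - ρ' • y‖
  calc _ ≤ ‖(ρ - ρ') • (x - v)‖ + ‖(ρ' - 1) • (x - y)‖ + ‖(x - y) - (w - w')‖ := norm_add₃_le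
    _ ≤ D * δ + δ * (2 * D) + K * δ * (2 * D) := by
      rw [norm_smul, norm_smul]
      gcongr
      · exact h1
      · rw [Real.norm_of_nonneg (by linarith)]; linarith
      · exact h.trans (by gcongr)
    _ = _ := by ring

end Radial

section Fibre
variable {E : Type*} [NormedAddCommGroup E] [InnerProductSpace ℝ E] [FiniteDimensional ℝ E]
  [MeasurableSpace E] [BorelSpace E] {p : ℕ}

/-- The surface measure of the unit sphere of `perp u`, as a measure on `E`. For an orthonormal
frame `u` this sphere is the set of vectors completing `u` to a longer frame. -/
def fibreMeasure (u : Tuple p E) : Measure E := (sphereMeasure (perp u)).map (↑)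

instance (u : Tuple p E) : IsFiniteMeasure (fibreMeasure u) := by
  unfold fibreMeasure; infer_instance

theorem WithLp.volume_image_toLp_prod {V₁ V₂ : Type*} [NormedAddCommGroup V₁]
    [InnerProductSpace ℝ V₁] [FiniteDimensional ℝ V₁] [MeasurableSpace V₁] [BorelSpace V₁]
    [NormedAddCommGroup V₂] [InnerProductSpace ℝ V₂] [FiniteDimensional ℝ V₂] [MeasurableSpace V₂]
    [BorelSpace V₂] (S : Set (V₁ × V₂)) :
    volume (WithLp.toLp 2 '' S) = (volume : Measure (V₁ × V₂)) S := by
  have h := (WithLp.volume_preserving_toLp V₁ V₂).measure_preimage_emb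
    (MeasurableEquiv.toLp 2 (V₁ × V₂)).measurableEmbedding (WithLp.toLp 2 '' S)
  rw [← h, Set.preimage_image_eq _ (WithLp.toLp_injective 2)]

/-- The volume of a truncated cone over `B`. -/
theorem volume_truncatedCone {u : Tuple p E} [Nontrivial (perp u)] {B : Set E}
    (hB : MeasurableSet B) (δ : ℝ) :
    volume {x : perp u | ‖x‖⁻¹ • (x : E) ∈ B ∧ ‖x‖ ∈ Set.Ioo 1 (1 + δ)} =
      fibreMeasure u B *
        ∫⁻ r in Set.Ioo 1 (1 + δ), ENNReal.ofReal (r ^ (finrank ℝ (perp u) - 1)) := by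
  have hB' : MeasurableSet ((↑) ⁻¹' B : Set (perp u)) := measurable_subtype_coe hB
  have := lintegral_polar (W := perp u) (g := ((↑) ⁻¹' B : Set (perp u)).indicator 1)
    (measurable_one.indicator hB') (h := (Set.Ioo 1 (1 + δ)).indicator 1)
    (measurable_one.indicator measurableSet_Ioo)
  rw [lintegral_indicator_one hB'] at this
  rw [fibreMeasure, Measure.map_apply measurable_subtype_coe hB]
  have hmeas : MeasurableSet
      {x : perp u | ‖x‖⁻¹ • (x : E) ∈ B ∧ ‖x‖ ∈ Set.Ioo 1 (1 + δ)} := by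
    have h1 : Measurable fun x : perp u => ‖x‖⁻¹ • (x : E) := by fun_prop
    exact (h1 hB).inter (measurable_norm measurableSet_Ioo)
  rw [← lintegral_indicator_one hmeas]
  convert this using 1
  · refine lintegral_congr fun x => ?_
    set S := {x : perp u | ‖x‖⁻¹ • (x : E) ∈ B ∧ ‖x‖ ∈ Set.Ioo 1 (1 + δ)} with hS
    by_cases h1 : ‖x‖⁻¹ • x ∈ ((↑) ⁻¹' B : Set (perp u))
    · by_cases h2 : ‖x‖ ∈ Set.Ioo 1 (1 + δ)
      · rw [Set.indicator_of_mem h1, Set.indicator_of_mem h2,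
          Set.indicator_of_mem (show x ∈ S from ⟨h1, h2⟩)]
        simp
      · rw [Set.indicator_of_notMem h2, Set.indicator_of_notMem (s := S) fun h => h2 h.2, mul_zero]
    · rw [Set.indicator_of_notMem h1, Set.indicator_of_notMem (s := S) fun h => h1 h.1, zero_mul]
  · congr 1
    rw [← lintegral_indicator measurableSet_Ioo, ← lintegral_indicator measurableSet_Ioi]
    refine lintegral_congr fun r => ?_
    simp only [Set.indicator_apply, Set.mem_Ioi, Pi.one_apply]
    split_ifs with h1 h2 <;> simp_all
    linarith [h1.1]

/-- Near `v`, the surface measure of the unit sphere of `perp u'` is close to Lebesgue measure in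
the projection to the tangent space at `v` of the unit sphere of `perp u`. Surface measure being defined
through Lebesgue measure on cones, the comparison is made for a truncated cone of height `δ`. -/
theorem fibreMeasure_comparison {u u' : Tuple p E} {v : E} {δ : ℝ} {κ : ℝ≥0} (hδ : 0 < δ)
    (hκ : 1 + δ ≤ κ) (hδκ : (2 * p + 5) * δ ≤ 1 - (κ : ℝ)⁻¹)
    (hw : Tuple.snoc u v ∈ frameSet (p + 1) E) (hu' : u' ∈ frameSet p E) (hu : ‖u' - u‖ ≤ δ)
    {B : Set E} (hB : MeasurableSet B) (hBv : ∀ x ∈ B, x ∈ perp u' ∧ ‖x‖ = 1 ∧ ‖x - v‖ ≤ δ)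
    {d : ℕ} (hd : finrank ℝ (perp u') = d) :
    volume ((perp (Tuple.snoc u v)).orthogonalProjectionOnto '' B) ≤
        κ ^ (2 * d) * fibreMeasure u' B ∧
      fibreMeasure u' B ≤
        κ ^ (2 * d) * volume ((perp (Tuple.snoc u v)).orthogonalProjectionOnto '' B) := by
  obtain ⟨hu1, hv, hv1⟩ := snoc_mem_frameSet.1 hw
  have hκ1 : (1 : ℝ≥0) ≤ κ := by
    have : (1 : ℝ) ≤ κ := by linarith
    exact_mod_cast this
  have hκ1' : (1 : ℝ≥0∞) ≤ κ := by exact_mod_cast hκ1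
  set P := (perp (Tuple.snoc u v)).orthogonalProjectionOnto with hP
  have hdim : finrank ℝ (WithLp 2 (ℝ × perp (Tuple.snoc u v))) = d := by
    have h1 := finrank_perp hw
    have h2 := finrank_perp hu'
    rw [(WithLp.linearEquiv 2 ℝ (ℝ × perp (Tuple.snoc u v))).finrank_eq, finrank_prod,
      finrank_self]
    omega
  have hd1 : 1 ≤ d := by
    rw [← hdim, (WithLp.linearEquiv 2 ℝ (ℝ × perp (Tuple.snoc u v))).finrank_eq, finrank_prod,
      finrank_self]
    omega
  have : Nontrivial (perp u') := nontrivial_of_finrank_pos (R := ℝ) (by omega)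
  have hWv : ∀ x ∈ perp (Tuple.snoc u v), ⟪v, x⟫_ℝ = 0 := fun x hx => (mem_perp_snoc.1 hx).2
  let L := radialLift v (perp (Tuple.snoc u v)) hv1 hWv
  -- the truncated cone over `B`
  let C : Set (perp u') := {x | ‖x‖⁻¹ • (x : E) ∈ B ∧ ‖x‖ ∈ Set.Ioo 1 (1 + δ)}
  let π : E → WithLp 2 (ℝ × perp (Tuple.snoc u v)) := fun x =>
    WithLp.toLp 2 (‖x‖, P (‖x‖⁻¹ • x))
  have hvolC := volume_truncatedCone (u := u') hB δ
  have hC : μHE[d] ((↑) '' C : Set E) = volume C := by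
    rw [isometry_subtype_coe.euclideanHausdorffMeasure_image, ← hd,
      InnerProductSpace.euclideanHausdorffMeasure_eq_volume]
  have himg : volume (π '' ((↑) '' C)) = ENNReal.ofReal δ * volume (P '' B) := by
    have : π '' ((↑) '' C) = WithLp.toLp 2 '' (Set.Ioo 1 (1 + δ) ×ˢ (P '' B)) := by
      ext z
      constructor
      · rintro ⟨_, ⟨x, hx, rfl⟩, rfl⟩
        exact ⟨_, ⟨hx.2, ⟨_, hx.1, rfl⟩⟩, rfl⟩
      · rintro ⟨⟨r, _⟩, ⟨hr, ⟨b, hb, rfl⟩⟩, rfl⟩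
        obtain ⟨hb1, hb2, -⟩ := hBv b hb
        have hr' : (1 : ℝ) < r ∧ r < 1 + δ := hr
        have hn : ‖r • b‖ = r := by
          rw [norm_smul, hb2, mul_one, Real.norm_of_nonneg (by linarith)]
        have hb' : ‖r • b‖⁻¹ • (r • b) = b := by
          rw [hn, smul_smul, inv_mul_cancel₀ (by linarith), one_smul]
        refine ⟨r • b, ⟨⟨r • b, Submodule.smul_mem _ _ hb1⟩, ⟨?_, ?_⟩, rfl⟩, ?_⟩
        · change ‖r • b‖⁻¹ • (r • b) ∈ B
          rwa [hb']
        · change ‖r • b‖ ∈ _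
          rwa [hn]
        · simp only [π]
          rw [hb', hn]
    rw [this, WithLp.volume_image_toLp_prod, Measure.volume_eq_prod, Measure.prod_prod,
      Real.volume_Ioo, add_sub_cancel_left]
  have hdist : ∀ x ∈ ((↑) '' C : Set E), ∀ y ∈ ((↑) '' C : Set E),
      ‖L.toLinearMap (π x - π y)‖ ≤ κ * ‖x - y‖ ∧ ‖x - y‖ ≤ κ * ‖L.toLinearMap (π x - π y)‖ := by
    rintro _ ⟨x, ⟨hxB, hx⟩, rfl⟩ _ ⟨y, ⟨hyB, hy⟩, rfl⟩
    refine norm_le_of_norm_sub_le (by exact_mod_cast hκ1) ?_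
    obtain ⟨hx1, hx2, hx3⟩ := hBv _ hxB
    obtain ⟨hy1, hy2, hy3⟩ := hBv _ hyB
    have hx0 : (1 : ℝ) < ‖x‖ := hx.1
    have hy0 : (1 : ℝ) < ‖y‖ := hy.1
    have h1 := norm_sub_starProjection_perp_le hw hu hx1 hy1 hx2 hy2 hx3 hy3
    rw [map_sub] at h1
    have h2 := norm_sub_radial_le (ρ := ‖x‖) (ρ' := ‖y‖) hδ.le (by positivity) hx2 hy2 hx3 hx0.le
      hy0.le hy.2.le h1
    rw [smul_smul, smul_smul, mul_inv_cancel₀ (by linarith), mul_inv_cancel₀ (by linarith),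
      one_smul, one_smul] at h2
    have h3 : L.toLinearMap (π x - π y) = (‖x‖ - ‖y‖) • v +
        ((perp (Tuple.snoc u v)).starProjection (‖x‖⁻¹ • (x : E)) -
          (perp (Tuple.snoc u v)).starProjection (‖y‖⁻¹ • (y : E))) := rfl
    rw [h3]
    refine h2.trans ?_
    gcongr
    linarith
  obtain ⟨hle, hge⟩ := euclideanHausdorffMeasure_comparison L.toLinearMap hdim
    (fun x hx y hy => (hdist x hx y hy).1) (fun x hx y hy => (hdist x hx y hy).2)
  rw [LinearIsometry.normDet_eq_one, ENNReal.ofReal_one, one_mul, himg, hC, hvolC, hd] at hle hge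
  set I := ∫⁻ r in Set.Ioo 1 (1 + δ), ENNReal.ofReal (r ^ (d - 1)) with hI
  have hI1 : ENNReal.ofReal δ ≤ I := by
    have : ENNReal.ofReal δ = ∫⁻ _ in Set.Ioo 1 (1 + δ), 1 := by simp
    rw [this]
    refine setLIntegral_mono' measurableSet_Ioo fun r hr => ?_
    rw [← ENNReal.ofReal_one]
    exact ENNReal.ofReal_le_ofReal (one_le_pow₀ hr.1.le)
  have hI2 : I ≤ κ ^ d * ENNReal.ofReal δ := by
    have : κ ^ d * ENNReal.ofReal δ = ∫⁻ _ in Set.Ioo 1 (1 + δ), (κ : ℝ≥0∞) ^ d := by simp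
    rw [this]
    refine setLIntegral_mono' measurableSet_Ioo fun r hr => ?_
    have hr1 : (1 : ℝ) < r := hr.1
    have hr2 : r < 1 + δ := hr.2
    rw [ENNReal.ofReal_pow (by linarith)]
    calc ENNReal.ofReal r ^ (d - 1) ≤ κ ^ (d - 1) := by
          gcongr
          exact ENNReal.ofReal_le_of_le_toReal (by simpa using by linarith)
      _ ≤ κ ^ d := pow_le_pow_right₀ hκ1' (by omega)
  have hδ0 : ENNReal.ofReal δ ≠ 0 := by simpa using hδ
  have hδt : ENNReal.ofReal δ ≠ ∞ := ENNReal.ofReal_ne_top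
  constructor
  · rw [← ENNReal.mul_le_mul_iff_right hδ0 hδt]
    calc _ ≤ κ ^ d * (fibreMeasure u' B * I) := hle
      _ ≤ κ ^ d * (fibreMeasure u' B * (κ ^ d * ENNReal.ofReal δ)) := by gcongr
      _ = _ := by ring
  · rw [← ENNReal.mul_le_mul_iff_right hδ0 hδt]
    calc ENNReal.ofReal δ * fibreMeasure u' B ≤ fibreMeasure u' B * I := by
          rw [mul_comm]; gcongr
      _ ≤ κ ^ d * (ENNReal.ofReal δ * volume (P '' B)) := hge
      _ ≤ κ ^ (2 * d) * (ENNReal.ofReal δ * volume (P '' B)) := by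
          gcongr ?_ * _
          exact pow_le_pow_right₀ hκ1' (by omega)
      _ = _ := by ring

end Fibre

/-! ### Extending a measure on frames by the surface measures of the fibres -/

section Extension
variable {E : Type*} [NormedAddCommGroup E] [InnerProductSpace ℝ E] {p : ℕ}

/-- The component of `x` along the span of `u`, if `u` is an orthonormal frame. -/
def spanPart (u : Tuple p E) (x : E) : E := ∑ i, ⟪u i, x⟫_ℝ • u i

theorem continuous_spanPart : Continuous fun z : Tuple p E × E => spanPart z.1 z.2 := by
  unfold spanPart
  fun_prop

variable [FiniteDimensional ℝ E]

theorem starProjection_perp_eq {u : Tuple p E} (hu : u ∈ frameSet p E) (x : E) :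
    (perp u).starProjection x = x - spanPart u x := starProjection_perp hu x

theorem starProjection_perp_orthogonal_eq {u : Tuple p E} (hu : u ∈ frameSet p E) (x : E) :
    (perp u)ᗮ.starProjection x = spanPart u x := by
  rw [Submodule.starProjection_orthogonal_val, starProjection_perp_eq hu, sub_sub_cancel]

variable [MeasurableSpace E] [BorelSpace E]

theorem volume_ball_eq_of_finrank_eq {V : Type*} [NormedAddCommGroup V] [InnerProductSpace ℝ V]
    [FiniteDimensional ℝ V] [MeasurableSpace V] [BorelSpace V] {m : ℕ} (hm : finrank ℝ V = m)
    (r : ℝ) : volume (Metric.ball (0 : V) r) =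
      volume (Metric.ball (0 : EuclideanSpace ℝ (Fin m)) r) := by
  subst hm
  have h := (stdOrthonormalBasis ℝ V).measurePreserving_repr.measure_preimage
    (s := Metric.ball (0 : EuclideanSpace ℝ (Fin (finrank ℝ V))) r)
    measurableSet_ball.nullMeasurableSet
  rw [← h]
  congr 1
  ext x
  simp

/-- Integration over `V` of a function of the components in `W` and `Wᗮ`. -/
theorem lintegral_mul_orthogonal {V : Type*} [NormedAddCommGroup V] [InnerProductSpace ℝ V]
    [FiniteDimensional ℝ V] [MeasurableSpace V] [BorelSpace V] (W : Submodule ℝ V)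
    {F : W → ℝ≥0∞} (hF : Measurable F) {K : Wᗮ → ℝ≥0∞} (hK : Measurable K) :
    ∫⁻ x, F (W.orthogonalProjectionOnto x) * K (Wᗮ.orthogonalProjectionOnto x) =
      (∫⁻ y, F y) * ∫⁻ z, K z := by
  have h := (WithLp.volume_preserving_ofLp W Wᗮ).comp W.orthogonalDecomposition.measurePreserving
  rw [← lintegral_prod_mul hF.aemeasurable hK.aemeasurable, ← Measure.volume_eq_prod,
    ← h.lintegral_comp (by fun_prop)]
  simp

/-- The region of pairs `(u, x)` over which the fibre measures are realized as images of Lebesgue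
measure. -/
def shell (p : ℕ) (E : Type*) [NormedAddCommGroup E] [InnerProductSpace ℝ E] :
    Set (Tuple p E × E) :=
  {z | ‖spanPart z.1 z.2‖ < 1 ∧ ‖z.2 - spanPart z.1 z.2‖ ∈ Set.Ioo 1 2}

/-- The volume of the sections of `shell p E`, relative to the total mass of the fibre measures. -/
def shellConst (p d : ℕ) : ℝ≥0∞ :=
  volume (Metric.ball (0 : EuclideanSpace ℝ (Fin p)) 1) *
    ∫⁻ r in Set.Ioo (1 : ℝ) 2, ENNReal.ofReal (r ^ (d - 1))

theorem shellConst_ne_zero (p d : ℕ) : shellConst p d ≠ 0 := by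
  refine mul_ne_zero (Metric.measure_ball_pos _ _ one_pos).ne' ?_
  have : (1 : ℝ≥0∞) ≤ ∫⁻ r in Set.Ioo (1 : ℝ) 2, ENNReal.ofReal (r ^ (d - 1)) := by
    calc (1 : ℝ≥0∞) = ∫⁻ _ in Set.Ioo (1 : ℝ) 2, 1 := by simp; norm_num
      _ ≤ _ := by
        refine setLIntegral_mono' measurableSet_Ioo fun r hr => ?_
        rw [← ENNReal.ofReal_one]
        exact ENNReal.ofReal_le_ofReal (one_le_pow₀ hr.1.le)
  exact (zero_lt_one.trans_le this).ne'

theorem shellConst_ne_top (p d : ℕ) : shellConst p d ≠ ∞ := by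
  refine ENNReal.mul_ne_top measure_ball_lt_top.ne ?_
  have : ∫⁻ r in Set.Ioo (1 : ℝ) 2, ENNReal.ofReal (r ^ (d - 1)) ≤
      ENNReal.ofReal (2 ^ (d - 1)) := by
    calc _ ≤ ∫⁻ _ in Set.Ioo (1 : ℝ) 2, ENNReal.ofReal (2 ^ (d - 1)) := by
          refine setLIntegral_mono' measurableSet_Ioo fun r hr => ?_
          exact ENNReal.ofReal_le_ofReal
            (pow_le_pow_left₀ (zero_le_one.trans hr.1.le) hr.2.le _)
      _ = _ := by simp; norm_num
  exact (this.trans_lt ENNReal.ofReal_lt_top).ne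

theorem measurableSet_shell : MeasurableSet (shell p E) := by
  have h1 : Measurable fun z : Tuple p E × E => ‖spanPart z.1 z.2‖ :=
    continuous_spanPart.norm.measurable
  have h2 : Measurable fun z : Tuple p E × E => ‖z.2 - spanPart z.1 z.2‖ :=
    (continuous_snd.sub continuous_spanPart).norm.measurable
  exact (h1 measurableSet_Iio).inter (h2 measurableSet_Ioo)

/-- The unit vector in direction of the component of `x` orthogonal to `u`. -/
def perpDirection (u : Tuple p E) (x : E) : E :=
  ‖x - spanPart u x‖⁻¹ • (x - spanPart u x)

theorem measurable_perpDirection :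
    Measurable fun z : Tuple p E × E => perpDirection z.1 z.2 := by
  have h2 : Measurable fun z : Tuple p E × E => z.2 - spanPart z.1 z.2 :=
    (continuous_snd.sub continuous_spanPart).measurable
  exact h2.norm.inv.smul h2

/-- On the section of `shell p E` over a frame `u`, Lebesgue measure is a product of a ball in the
span of `u` and a spherical shell in `perp u`; the second factor is integrated in polar
coordinates. -/
theorem lintegral_shell_section {u : Tuple p E} (hu : u ∈ frameSet p E) {d : ℕ}
    (hd : finrank ℝ (perp u) = d) (hd0 : d ≠ 0) {f : E → ℝ≥0∞} (hf : Measurable f) :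
    ∫⁻ x, (shell p E).indicator (fun z => f (perpDirection z.1 z.2)) (u, x) =
      shellConst p d * ∫⁻ v, f v ∂(fibreMeasure u) := by
  have : Nontrivial (perp u) := nontrivial_of_finrank_pos (R := ℝ) (by omega)
  let F : perp u → ℝ≥0∞ := fun y => f (‖y‖⁻¹ • y : perp u) *
    (Set.Ioo (1 : ℝ) 2).indicator 1 ‖y‖
  let K : (perp u)ᗮ → ℝ≥0∞ := (Metric.ball 0 1).indicator 1
  have hind : Measurable ((Set.Ioo (1 : ℝ) 2).indicator (1 : ℝ → ℝ≥0∞)) :=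
    measurable_one.indicator measurableSet_Ioo
  have hfc : Measurable fun y : perp u => f y := hf.comp measurable_subtype_coe
  have hF : Measurable F := by
    refine Measurable.mul ?_ (hind.comp measurable_norm)
    exact hfc.comp (measurable_norm.inv.smul measurable_id)
  have hK : Measurable K := measurable_one.indicator measurableSet_ball
  have h1 : ∀ x, (shell p E).indicator (fun z => f (perpDirection z.1 z.2)) (u, x) =
      F ((perp u).orthogonalProjectionOnto x) * K ((perp u)ᗮ.orthogonalProjectionOnto x) := by
    intro x
    have e1 : ((perp u).orthogonalProjectionOnto x : E) = x - spanPart u x :=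
      starProjection_perp_eq hu x
    have e2 : ((perp u)ᗮ.orthogonalProjectionOnto x : E) = spanPart u x :=
      starProjection_perp_orthogonal_eq hu x
    have n1 : ‖(perp u).orthogonalProjectionOnto x‖ = ‖x - spanPart u x‖ := by
      rw [← e1]; rfl
    have n2 : ‖(perp u)ᗮ.orthogonalProjectionOnto x‖ = ‖spanPart u x‖ := by
      rw [← e2]; rfl
    have e3 : ((‖(perp u).orthogonalProjectionOnto x‖⁻¹ •
        (perp u).orthogonalProjectionOnto x : perp u) : E) = perpDirection u x := by
      rw [Submodule.coe_smul, e1, n1]; rfl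
    simp only [F, K]
    rw [e3, n1]
    by_cases hQ : ‖spanPart u x‖ < 1
    · by_cases hR : ‖x - spanPart u x‖ ∈ Set.Ioo (1 : ℝ) 2
      · rw [Set.indicator_of_mem (show (u, x) ∈ shell p E from ⟨hQ, hR⟩),
          Set.indicator_of_mem hR, Set.indicator_of_mem (by simpa [n2] using hQ)]
        simp
      · rw [Set.indicator_of_notMem (show (u, x) ∉ shell p E from fun h => hR h.2),
          Set.indicator_of_notMem hR]
        simp
    · rw [Set.indicator_of_notMem (show (u, x) ∉ shell p E from fun h => hQ h.1),
        Set.indicator_of_notMem (s := Metric.ball _ _) (by simpa [n2] using hQ)]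
      simp
  rw [lintegral_congr h1, lintegral_mul_orthogonal _ hF hK]
  have hfin : finrank ℝ ((perp u)ᗮ : Submodule ℝ E) = p := by
    have a1 := finrank_perp hu
    have a2 := Submodule.finrank_add_finrank_orthogonal (perp u)
    omega
  have hpol := lintegral_polar hfc hind
  have hK' : ∫⁻ z, K z = volume (Metric.ball (0 : EuclideanSpace ℝ (Fin p)) 1) := by
    rw [lintegral_indicator_one measurableSet_ball, volume_ball_eq_of_finrank_eq hfin]
  have hr : ∫⁻ r in Set.Ioi (0 : ℝ), ENNReal.ofReal (r ^ (finrank ℝ (perp u) - 1)) *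
      (Set.Ioo (1 : ℝ) 2).indicator 1 r =
        ∫⁻ r in Set.Ioo (1 : ℝ) 2, ENNReal.ofReal (r ^ (d - 1)) := by
    rw [hd, ← lintegral_indicator measurableSet_Ioo, ← lintegral_indicator measurableSet_Ioi]
    refine lintegral_congr fun r => ?_
    by_cases hr : r ∈ Set.Ioo (1 : ℝ) 2
    · have hr0 : r ∈ Set.Ioi (0 : ℝ) := zero_lt_one.trans hr.1
      simp [Set.indicator_of_mem hr, Set.indicator_of_mem hr0]
    · simp [Set.indicator_of_notMem hr]
  rw [hK', hpol, hr, fibreMeasure, lintegral_map hf measurable_subtype_coe, shellConst]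
  ring

/-- For a measure `m` carried by the orthonormal `p`-frames, the measure on `(p + 1)`-frames with
marginal density `m` and with fibres `fibreMeasure`, see `lintegral_extendMeasure`. It is defined
as an image of `m × volume` so that no measurable choice of the fibres is needed. -/
def extendMeasure (m : Measure (Tuple p E)) : Measure (Tuple (p + 1) E) :=
  (shellConst p (finrank ℝ E - p))⁻¹ •
    ((m.prod volume).restrict (shell p E)).map
      fun z => Tuple.snoc z.1 (perpDirection z.1 z.2)

theorem lintegral_extendMeasure (m : Measure (Tuple p E)) [SFinite m]
    (hm : ∀ᵐ u ∂m, u ∈ frameSet p E) (hp : p < finrank ℝ E)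
    {f : Tuple (p + 1) E → ℝ≥0∞} (hf : Measurable f) :
    ∫⁻ w, f w ∂(extendMeasure m) =
      ∫⁻ u, ∫⁻ v, f (Tuple.snoc u v) ∂(fibreMeasure u) ∂m := by
  have hG : Measurable fun z : Tuple p E × E => Tuple.snoc z.1 (perpDirection z.1 z.2) :=
    Tuple.continuous_snoc.measurable.comp (measurable_fst.prodMk measurable_perpDirection)
  have hc0 := shellConst_ne_zero p (finrank ℝ E - p)
  have hct := shellConst_ne_top p (finrank ℝ E - p)
  rw [extendMeasure, lintegral_smul_measure, lintegral_map hf hG,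
    ← lintegral_indicator measurableSet_shell, lintegral_prod
      ((shell p E).indicator fun z : Tuple p E × E => f (Tuple.snoc z.1 (perpDirection z.1 z.2)))
      ((hf.comp hG).indicator measurableSet_shell).aemeasurable]
  have : ∫⁻ u, (∫⁻ x : E, (shell p E).indicator
      (fun z => f (Tuple.snoc z.1 (perpDirection z.1 z.2))) (u, x)) ∂m =
      ∫⁻ u, shellConst p (finrank ℝ E - p) *
        ∫⁻ v, f (Tuple.snoc u v) ∂(fibreMeasure u) ∂m := by
    refine lintegral_congr_ae ?_
    filter_upwards [hm] with u hu
    have hd := finrank_perp hu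
    have hfu : Measurable fun v => f (Tuple.snoc u v) :=
      hf.comp (Tuple.continuous_snoc.measurable.comp measurable_prodMk_left)
    rw [← lintegral_shell_section hu (by omega) (by omega) hfu]
    rfl
  rw [this, lintegral_const_mul' _ _ hct, smul_eq_mul, ← mul_assoc, ENNReal.inv_mul_cancel hc0 hct,
    one_mul]

theorem extendMeasure_apply (m : Measure (Tuple p E)) [SFinite m]
    (hm : ∀ᵐ u ∂m, u ∈ frameSet p E) (hp : p < finrank ℝ E)
    {A : Set (Tuple (p + 1) E)} (hA : MeasurableSet A) :
    extendMeasure m A = ∫⁻ u, fibreMeasure u {v | Tuple.snoc u v ∈ A} ∂m := by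
  have := lintegral_extendMeasure m hm hp (measurable_one.indicator hA)
  rw [lintegral_indicator_one hA] at this
  rw [this]
  refine lintegral_congr fun u => ?_
  have hAu : MeasurableSet {v | Tuple.snoc u v ∈ A} :=
    (Tuple.continuous_snoc.measurable.comp measurable_prodMk_left) hA
  rw [← lintegral_indicator_one hAu]
  rfl

end Extension

/-! ### The Hausdorff measure on the manifold of frames -/

/-- If a map distorts the measure of subsets of `N` by a factor at most `c`, it changes integrals
over `N` by a factor at most `c`. -/
theorem lintegral_comp_comparison {X V : Type*} [MeasurableSpace X] [MeasurableSpace V]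
    {μ : Measure X} {ν : Measure V} {N : Set X} (hN : MeasurableSet N) {f : X → V}
    (hf : Measurable f) {c : ℝ≥0∞}
    (h : ∀ A, MeasurableSet A → A ⊆ N → ν (f '' A) ≤ c * μ A ∧ μ A ≤ c * ν (f '' A))
    {g : V → ℝ≥0∞} (hg : Measurable g) :
    ∫⁻ y in f '' N, g y ∂ν ≤ c * ∫⁻ x in N, g (f x) ∂μ ∧
      ∫⁻ x in N, g (f x) ∂μ ≤ c * ∫⁻ y in f '' N, g y ∂ν := by
  have himg : ∀ B : Set V, f '' (f ⁻¹' B ∩ N) = B ∩ f '' N := fun B => by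
    rw [Set.inter_comm, Set.image_inter_preimage, Set.inter_comm]
  rw [← lintegral_map hg hf, ← smul_eq_mul, ← smul_eq_mul, ← lintegral_smul_measure,
    ← lintegral_smul_measure]
  constructor
  · refine lintegral_mono' (Measure.le_iff.2 fun B hB => ?_) le_rfl
    rw [Measure.smul_apply, Measure.map_apply hf hB, Measure.restrict_apply hB,
      Measure.restrict_apply (hf hB), ← himg]
    exact (h _ ((hf hB).inter hN) Set.inter_subset_right).1
  · refine lintegral_mono' (Measure.le_iff.2 fun B hB => ?_) le_rfl
    rw [Measure.smul_apply, Measure.map_apply hf hB, Measure.restrict_apply hB,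
      Measure.restrict_apply (hf hB), ← himg]
    exact (h _ ((hf hB).inter hN) Set.inter_subset_right).2

/-- The dimension of the manifold of orthonormal `p`-frames in dimension `q`. -/
def frameDim (q p : ℕ) : ℕ := p * (2 * q - p - 1) / 2

section FrameMeasure
variable {E : Type*} [NormedAddCommGroup E] [InnerProductSpace ℝ E] [FiniteDimensional ℝ E]
  {p : ℕ} {δ : ℝ} {κ : ℝ≥0}

theorem injOn_of_norm_le {X Y : Type*} [NormedAddCommGroup X] [NormedAddCommGroup Y]
    {A : Set X} {f : X → Y} {κ : ℝ} (h : ∀ x ∈ A, ∀ y ∈ A, ‖x - y‖ ≤ κ * ‖f x - f y‖) :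
    Set.InjOn f A := by
  intro x hx y hy hxy
  have := h x hx y hy
  rw [hxy, sub_self, norm_zero, mul_zero] at this
  exact sub_eq_zero.1 (norm_le_zero_iff.1 this)

theorem frameTangent_distortion {u x y : Tuple p E} (hκ : (1 : ℝ) ≤ κ)
    (hδκ : p ^ 2 * δ ≤ 1 - (κ : ℝ)⁻¹) (hu : u ∈ frameSet p E)
    (hx : x ∈ frameSet p E ∩ Metric.closedBall u δ)
    (hy : y ∈ frameSet p E ∩ Metric.closedBall u δ) :
    ‖(frameTangent u).orthogonalProjectionOnto x - (frameTangent u).orthogonalProjectionOnto y‖ ≤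
        κ * ‖x - y‖ ∧
      ‖x - y‖ ≤ κ * ‖(frameTangent u).orthogonalProjectionOnto x -
        (frameTangent u).orthogonalProjectionOnto y‖ := by
  have h1 := norm_sub_starProjection_frameTangent_le hu hx.1 hy.1
    (mem_closedBall_iff_norm.1 hx.2) (mem_closedBall_iff_norm.1 hy.2)
  have h2 := norm_le_of_norm_sub_le hκ (h1.trans (by gcongr))
  rw [← map_sub]
  exact h2

theorem frameCoord_distortion {u : Tuple p E} {v : E} {x y : Tuple (p + 1) E} (hκ : (1 : ℝ) ≤ κ)
    (hδκ : (p ^ 3 + p ^ 2 + 2 * p + 1) * δ ≤ 1 - (κ : ℝ)⁻¹)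
    (hw : Tuple.snoc u v ∈ frameSet (p + 1) E)
    (hx : x ∈ frameSet (p + 1) E ∩ Metric.closedBall (Tuple.snoc u v) δ)
    (hy : y ∈ frameSet (p + 1) E ∩ Metric.closedBall (Tuple.snoc u v) δ) :
    ‖frameLift u v (frameCoord u v x - frameCoord u v y)‖ ≤ κ * ‖x - y‖ ∧
      ‖x - y‖ ≤ κ * ‖frameLift u v (frameCoord u v x - frameCoord u v y)‖ := by
  have h1 := norm_sub_frameLift_frameCoord_le hw hx.1 hy.1
    (mem_closedBall_iff_norm.1 hx.2) (mem_closedBall_iff_norm.1 hy.2)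
  exact norm_le_of_norm_sub_le hκ (h1.trans (by gcongr))

variable [MeasurableSpace E] [BorelSpace E]

theorem frameTangent_comparison {u : Tuple p E} (hκ : (1 : ℝ) ≤ κ)
    (hδκ : p ^ 2 * δ ≤ 1 - (κ : ℝ)⁻¹) (hu : u ∈ frameSet p E) {A : Set (Tuple p E)}
    (hA : A ⊆ frameSet p E ∩ Metric.closedBall u δ) :
    volume ((frameTangent u).orthogonalProjectionOnto '' A) ≤
        κ ^ frameDim (finrank ℝ E) p * μHE[frameDim (finrank ℝ E) p] A ∧
      μHE[frameDim (finrank ℝ E) p] A ≤ κ ^ frameDim (finrank ℝ E) p *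
        volume ((frameTangent u).orthogonalProjectionOnto '' A) := by
  have h := euclideanHausdorffMeasure_comparison (A := A)
    (π := (frameTangent u).orthogonalProjectionOnto) (frameTangent u).subtype
    (finrank_frameTangent_eq hu)
    (fun x hx y hy => (frameTangent_distortion hκ hδκ hu (hA hx) (hA hy)).1)
    (fun x hx y hy => (frameTangent_distortion hκ hδκ hu (hA hx) (hA hy)).2)
  rw [LinearMap.normDet_subtype, ENNReal.ofReal_one, one_mul] at h
  exact h

theorem frameCoord_comparison {u : Tuple p E} {v : E} (hκ : (1 : ℝ) ≤ κ)
    (hδκ : (p ^ 3 + p ^ 2 + 2 * p + 1) * δ ≤ 1 - (κ : ℝ)⁻¹)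
    (hw : Tuple.snoc u v ∈ frameSet (p + 1) E) {A : Set (Tuple (p + 1) E)}
    (hA : A ⊆ frameSet (p + 1) E ∩ Metric.closedBall (Tuple.snoc u v) δ) :
    ENNReal.ofReal (2 ^ ((p : ℝ) / 2)) * volume (frameCoord u v '' A) ≤
        κ ^ frameDim (finrank ℝ E) (p + 1) * μHE[frameDim (finrank ℝ E) (p + 1)] A ∧
      μHE[frameDim (finrank ℝ E) (p + 1)] A ≤ κ ^ frameDim (finrank ℝ E) (p + 1) *
        (ENNReal.ofReal (2 ^ ((p : ℝ) / 2)) * volume (frameCoord u v '' A)) := by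
  have hdim : finrank ℝ (WithLp 2 (frameTangent u × perp (Tuple.snoc u v))) =
      frameDim (finrank ℝ E) (p + 1) := by
    rw [← LinearMap.finrank_range_of_inj (frameLift_injective u v), range_frameLift hw,
      finrank_frameTangent_eq hw]
    rfl
  rw [← normDet_frameLift hw]
  exact euclideanHausdorffMeasure_comparison (frameLift u v) hdim
    (fun x hx y hy => (frameCoord_distortion hκ hδκ hw (hA hx) (hA hy)).1)
    (fun x hx y hy => (frameCoord_distortion hκ hδκ hw (hA hx) (hA hy)).2)

/-- The Hausdorff measure on the manifold of orthonormal `p`-frames. -/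
def frameMeasure (p : ℕ) (E : Type*) [NormedAddCommGroup E] [InnerProductSpace ℝ E]
    [FiniteDimensional ℝ E] [MeasurableSpace E] [BorelSpace E] : Measure (Tuple p E) :=
  μHE[frameDim (finrank ℝ E) p].restrict (frameSet p E)

theorem ae_fibreMeasure_mem (u : Tuple p E) : ∀ᵐ v ∂(fibreMeasure u), v ∈ perp u ∧ ‖v‖ = 1 := by
  have hm : MeasurableSet {v | v ∈ perp u ∧ ‖v‖ = 1} :=
    (perp u).closed_of_finiteDimensional.measurableSet.inter
      (measurable_norm (measurableSet_singleton 1))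
  rw [fibreMeasure, ae_map_iff measurable_subtype_coe.aemeasurable hm]
  filter_upwards [ae_sphereMeasure_norm (W := perp u)] with v hv using ⟨v.2, hv⟩

theorem measurableSet_frameSet : MeasurableSet (frameSet p E) := isClosed_frameSet.measurableSet

theorem ae_frameMeasure_mem : ∀ᵐ u ∂(frameMeasure p E), u ∈ frameSet p E :=
  ae_restrict_mem measurableSet_frameSet

instance : IsFiniteMeasure (frameMeasure p E) := by
  constructor
  rw [frameMeasure, Measure.restrict_apply_univ]
  refine isCompact_frameSet.measure_lt_top_of_nhdsWithin fun u hu => ?_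
  obtain ⟨δ, hδ, hδ'⟩ : ∃ δ : ℝ, 0 < δ ∧ p ^ 2 * δ ≤ 1 - ((2 : ℝ≥0) : ℝ)⁻¹ := by
    refine ⟨(2 * (p ^ 2 + 1))⁻¹, by positivity, ?_⟩
    rw [← div_eq_mul_inv, div_le_iff₀ (by positivity)]
    norm_num
    nlinarith [sq_nonneg (p : ℝ)]
  refine ⟨frameSet p E ∩ Metric.closedBall u δ, Filter.inter_mem self_mem_nhdsWithin
    (mem_nhdsWithin_of_mem_nhds (Metric.closedBall_mem_nhds u hδ)), ?_⟩
  refine (frameTangent_comparison (by norm_num) hδ' hu Set.Subset.rfl).2.trans_lt ?_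
  refine ENNReal.mul_lt_top (by finiteness) ?_
  refine Bornology.IsBounded.measure_lt_top ?_
  exact ((frameTangent u).orthogonalProjectionOnto.lipschitz).isBounded_image
    (Metric.isBounded_closedBall.subset Set.inter_subset_right)

/-- Near a frame, `extendMeasure` is close to Lebesgue measure in the coordinates `frameCoord`. -/
theorem extendMeasure_comparison {u : Tuple p E} {v : E} (hδ : 0 < δ)
    (hκ : 1 + δ ≤ κ) (hδκ : (p ^ 3 + p ^ 2 + 2 * p + 5) * δ ≤ 1 - (κ : ℝ)⁻¹)
    (hw : Tuple.snoc u v ∈ frameSet (p + 1) E) {A : Set (Tuple (p + 1) E)}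
    (hA : A ⊆ frameSet (p + 1) E ∩ Metric.closedBall (Tuple.snoc u v) δ) (hAm : MeasurableSet A)
    {r : ℕ} (hr : frameDim (finrank ℝ E) p + 2 * (finrank ℝ E - p) = r) :
    volume (frameCoord u v '' A) ≤ κ ^ r * extendMeasure (frameMeasure p E) A ∧
      extendMeasure (frameMeasure p E) A ≤ κ ^ r * volume (frameCoord u v '' A) := by
  have hκ1 : (1 : ℝ) ≤ κ := by linarith
  obtain ⟨hu, hv, hv1⟩ := snoc_mem_frameSet.1 hw
  have hp0 : (0 : ℝ) ≤ p := by positivity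
  have hδ1 : (p ^ 3 + p ^ 2 + 2 * p + 1) * δ ≤ 1 - (κ : ℝ)⁻¹ := by
    refine le_trans ?_ hδκ; gcongr; norm_num
  have hδ2 : p ^ 2 * δ ≤ 1 - (κ : ℝ)⁻¹ := by
    refine le_trans ?_ hδκ; gcongr; nlinarith [pow_nonneg hp0 3]
  have hδ3 : (2 * p + 5) * δ ≤ 1 - (κ : ℝ)⁻¹ := by
    refine le_trans ?_ hδκ; gcongr; nlinarith [pow_nonneg hp0 3, pow_nonneg hp0 2]
  have hpq : p < finrank ℝ E := by have := finrank_perp hw; omega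
  rw [extendMeasure_apply _ ae_frameMeasure_mem hpq hAm]
  set T := frameTangent u
  set W := perp (Tuple.snoc u v)
  set N := frameSet p E ∩ Metric.closedBall u δ with hN
  have hNm : MeasurableSet N := measurableSet_frameSet.inter measurableSet_closedBall
  -- sections of `A` are empty outside `N`
  have hsec : ∀ u', ∀ x ∈ {x | Tuple.snoc u' x ∈ A}, u' ∈ N ∧ x ∈ perp u' ∧ ‖x‖ = 1 ∧
      ‖x - v‖ ≤ δ := by
    intro u' x hx
    obtain ⟨h1, h2⟩ := hA hx
    obtain ⟨h3, h4, h5⟩ := snoc_mem_frameSet.1 h1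
    rw [mem_closedBall_iff_norm] at h2
    refine ⟨⟨h3, ?_⟩, h4, h5, ?_⟩
    · rw [mem_closedBall_iff_norm]
      simpa [Tuple.init_sub] using (Tuple.norm_init_le _).trans h2
    · simpa [Tuple.last_sub] using (Tuple.norm_last_le _).trans h2
  have hsecm : ∀ u', MeasurableSet {x | Tuple.snoc u' x ∈ A} := fun u' =>
    (Tuple.continuous_snoc.measurable.comp measurable_prodMk_left) hAm
  have hrestrict : ∫⁻ u', fibreMeasure u' {x | Tuple.snoc u' x ∈ A} ∂(frameMeasure p E) =
      ∫⁻ u' in N, fibreMeasure u' {x | Tuple.snoc u' x ∈ A} ∂μHE[frameDim (finrank ℝ E) p] := by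
    have h1 : (fun u' => fibreMeasure u' {x | Tuple.snoc u' x ∈ A}) =
        N.indicator fun u' => fibreMeasure u' {x | Tuple.snoc u' x ∈ A} := by
      ext u'
      by_cases h : u' ∈ N
      · rw [Set.indicator_of_mem h]
      · rw [Set.indicator_of_notMem h]
        have : {x | Tuple.snoc u' x ∈ A} = ∅ :=
          Set.eq_empty_of_forall_notMem fun x hx => h (hsec u' x hx).1
        rw [this, measure_empty]
    rw [h1, lintegral_indicator hNm, frameMeasure, Measure.restrict_restrict hNm,
      Set.inter_eq_left.2 (Set.inter_subset_left : N ⊆ frameSet p E)]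
    refine setLIntegral_congr_fun hNm fun u' hu' => ?_
    exact (Set.indicator_of_mem hu' fun u' => fibreMeasure u' {x | Tuple.snoc u' x ∈ A}).symm
  rw [hrestrict]
  -- the image of `A` in coordinates
  have hinj : Set.InjOn (fun w : Tuple (p + 1) E => frameLift u v (frameCoord u v w)) A :=
    injOn_of_norm_le (κ := κ) fun x hx y hy => by
      rw [← map_sub]; exact (frameCoord_distortion hκ1 hδ1 hw (hA hx) (hA hy)).2
  let S : Set (T × W) := (fun w : Tuple (p + 1) E =>
    (T.orthogonalProjectionOnto w.init, W.orthogonalProjectionOnto w.last)) '' A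
  have hScoord : frameCoord u v '' A = WithLp.toLp 2 '' S := by
    rw [Set.image_image]; rfl
  have hcont : Continuous fun w : Tuple (p + 1) E =>
      (T.orthogonalProjectionOnto w.init, W.orthogonalProjectionOnto w.last) :=
    (T.orthogonalProjectionOnto.continuous.comp Tuple.continuous_init).prodMk
      (W.orthogonalProjectionOnto.continuous.comp Tuple.continuous_last)
  have hSm : MeasurableSet S := by
    refine hAm.image_of_continuousOn_injOn hcont.continuousOn fun x hx y hy hxy => hinj hx hy ?_
    have : frameCoord u v x = frameCoord u v y := congrArg (WithLp.toLp 2) hxy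
    simp only [this]
  have hTinj : Set.InjOn T.orthogonalProjectionOnto N :=
    injOn_of_norm_le (κ := κ) fun x hx y hy => (frameTangent_distortion hκ1 hδ2 hu hx hy).2
  let g : T → ℝ≥0∞ := fun ξ => volume (Prod.mk ξ ⁻¹' S)
  have hg : Measurable g := measurable_measure_prodMk_left hSm
  have hSsec : ∀ u' ∈ N, Prod.mk (T.orthogonalProjectionOnto u') ⁻¹' S =
      W.orthogonalProjectionOnto '' {x | Tuple.snoc u' x ∈ A} := by
    intro u' hu'
    ext η
    constructor
    · rintro ⟨w, hwA, hwe⟩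
      rw [Prod.mk_inj] at hwe
      have h1 := (hsec w.init w.last (by simpa using hwA)).1
      have h2 := hTinj h1 hu' hwe.1
      refine ⟨w.last, ?_, hwe.2⟩
      rw [← h2]
      simpa using hwA
    · rintro ⟨x, hx, rfl⟩
      exact ⟨_, hx, by simp⟩
  have hvol : volume (frameCoord u v '' A) =
      ∫⁻ ξ in T.orthogonalProjectionOnto '' N, g ξ := by
    have hTN : MeasurableSet (T.orthogonalProjectionOnto '' N) :=
      hNm.image_of_continuousOn_injOn T.orthogonalProjectionOnto.continuous.continuousOn hTinj
    rw [hScoord, WithLp.volume_image_toLp_prod, Measure.volume_eq_prod, Measure.prod_apply hSm,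
      ← lintegral_indicator hTN]
    refine lintegral_congr fun ξ => ?_
    by_cases h : ξ ∈ T.orthogonalProjectionOnto '' N
    · rw [Set.indicator_of_mem h]
    · rw [Set.indicator_of_notMem h]
      have : Prod.mk ξ ⁻¹' S = ∅ := by
        refine Set.eq_empty_of_forall_notMem fun η => ?_
        rintro ⟨w, hwA, hwe⟩
        rw [Prod.mk_inj] at hwe
        exact h ⟨w.init, (hsec w.init w.last (by simpa using hwA)).1, hwe.1⟩
      rw [this, measure_empty]
  have hfib : ∀ u' ∈ N,
      g (T.orthogonalProjectionOnto u') ≤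
          κ ^ (2 * (finrank ℝ E - p)) * fibreMeasure u' {x | Tuple.snoc u' x ∈ A} ∧
        fibreMeasure u' {x | Tuple.snoc u' x ∈ A} ≤
          κ ^ (2 * (finrank ℝ E - p)) * g (T.orthogonalProjectionOnto u') := by
    intro u' hu'
    have hd : finrank ℝ (perp u') = finrank ℝ E - p := by
      have := finrank_perp hu'.1; omega
    simp only [g]
    rw [hSsec u' hu']
    exact fibreMeasure_comparison hδ hκ hδ3 hw hu'.1 (mem_closedBall_iff_norm.1 hu'.2)
      (hsecm u') (fun x hx => (hsec u' x hx).2) hd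
  obtain ⟨hc1, hc2⟩ := lintegral_comp_comparison (ν := volume)
    (μ := μHE[frameDim (finrank ℝ E) p]) hNm T.orthogonalProjectionOnto.continuous.measurable
    (fun B _ hB => frameTangent_comparison hκ1 hδ2 hu hB) hg
  have hκt : ∀ s : ℕ, (κ : ℝ≥0∞) ^ s ≠ ∞ := fun s => by finiteness
  rw [hvol, ← hr, pow_add]
  constructor
  · refine hc1.trans ?_
    rw [mul_assoc]
    refine mul_le_mul_right ?_ _
    rw [← lintegral_const_mul' _ _ (hκt _)]
    exact setLIntegral_mono' hNm fun u' hu' => (hfib u' hu').1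
  · calc _ ≤ ∫⁻ u' in N, κ ^ (2 * (finrank ℝ E - p)) * g (T.orthogonalProjectionOnto u')
            ∂μHE[frameDim (finrank ℝ E) p] :=
          setLIntegral_mono' hNm fun u' hu' => (hfib u' hu').2
      _ ≤ _ := by
        rw [lintegral_const_mul' _ _ (hκt _), mul_comm (κ ^ frameDim _ _ : ℝ≥0∞), mul_assoc]
        gcongr

/-- Given `η > 1`, the constants of the local comparison can be chosen with `κ ^ r ≤ η`. -/
theorem exists_distortion_bounds (C : ℝ) (hC : 0 ≤ C) (r : ℕ) {η : ℝ≥0} (hη : 1 < η) :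
    ∃ κ : ℝ≥0, ∃ δ : ℝ, 0 < δ ∧ 1 + δ ≤ κ ∧ C * δ ≤ 1 - (κ : ℝ)⁻¹ ∧ κ ^ r ≤ η := by
  have hcont : Filter.Tendsto (fun κ : ℝ≥0 => κ ^ r) (nhdsWithin 1 (Set.Ioi 1)) (nhds 1) := by
    have : Filter.Tendsto (fun κ : ℝ≥0 => κ ^ r) (nhds 1) (nhds (1 ^ r)) :=
      (continuous_pow r).tendsto 1
    rw [one_pow] at this
    exact this.mono_left nhdsWithin_le_nhds
  obtain ⟨κ, hκ, hκη⟩ := ((eventually_mem_nhdsWithin).and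
    (hcont.eventually (eventually_le_nhds hη))).exists
  have hκ1 : (1 : ℝ) < κ := by exact_mod_cast hκ
  have h2 : (0 : ℝ) < 1 - (κ : ℝ)⁻¹ := by
    have := inv_lt_one_of_one_lt₀ hκ1
    linarith
  refine ⟨κ, min (κ - 1) ((1 - (κ : ℝ)⁻¹) / (C + 1)), lt_min (by linarith) (by positivity),
    ?_, ?_, hκη⟩
  · have := min_le_left ((κ : ℝ) - 1) ((1 - (κ : ℝ)⁻¹) / (C + 1))
    linarith
  · calc _ ≤ C * ((1 - (κ : ℝ)⁻¹) / (C + 1)) := by gcongr; exact min_le_right _ _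
      _ ≤ (C + 1) * ((1 - (κ : ℝ)⁻¹) / (C + 1)) := by gcongr; linarith
      _ = _ := by field_simp

/-- The Hausdorff measure on `(p + 1)`-frames fibres over the Hausdorff measure on `p`-frames. The
factor `2 ^ (p / 2)` appears because the motion of the last vector towards the `i`-th one forces an
equal motion of the `i`-th vector. -/
theorem frameMeasure_succ (hp : p < finrank ℝ E) :
    frameMeasure (p + 1) E =
      ENNReal.ofReal (2 ^ ((p : ℝ) / 2)) • extendMeasure (frameMeasure p E) := by
  set c := ENNReal.ofReal (2 ^ ((p : ℝ) / 2)) with hc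
  have hloc : ∀ η : ℝ≥0, 1 < η → ∀ w ∈ frameSet (p + 1) E, ∃ N ∈ nhds w, ∀ A,
      MeasurableSet A → A ⊆ N ∩ frameSet (p + 1) E →
      μHE[frameDim (finrank ℝ E) (p + 1)] A ≤
          η * (c • extendMeasure (frameMeasure p E)) A ∧
        (c • extendMeasure (frameMeasure p E)) A ≤
          η * μHE[frameDim (finrank ℝ E) (p + 1)] A := by
    intro η hη w hw
    obtain ⟨κ, δ, hδ, hκ, hδκ, hκη⟩ := exists_distortion_bounds
      ((p : ℝ) ^ 3 + p ^ 2 + 2 * p + 5) (by positivity) (frameDim (finrank ℝ E) (p + 1) +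
        (frameDim (finrank ℝ E) p + 2 * (finrank ℝ E - p))) hη
    refine ⟨_, Metric.closedBall_mem_nhds w hδ, fun A hA hAw => ?_⟩
    rw [← w.snoc_init_last] at hw hAw
    rw [Set.inter_comm] at hAw
    have hδ1 : (p ^ 3 + p ^ 2 + 2 * p + 1) * δ ≤ 1 - (κ : ℝ)⁻¹ := by
      refine le_trans ?_ hδκ; gcongr; norm_num
    obtain ⟨a1, a2⟩ := frameCoord_comparison (by linarith) hδ1 hw hAw
    obtain ⟨b1, b2⟩ := extendMeasure_comparison hδ hκ hδκ hw hAw hA rfl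
    have hκη' : (κ : ℝ≥0∞) ^ (frameDim (finrank ℝ E) (p + 1) +
        (frameDim (finrank ℝ E) p + 2 * (finrank ℝ E - p))) ≤ η := by exact_mod_cast hκη
    rw [pow_add] at hκη'
    rw [Measure.smul_apply, smul_eq_mul]
    constructor
    · refine (a2.trans (mul_le_mul_right (mul_le_mul_right b1 c) _)).trans ?_
      calc _ = (κ ^ frameDim (finrank ℝ E) (p + 1) *
            κ ^ (frameDim (finrank ℝ E) p + 2 * (finrank ℝ E - p))) *
              (c * extendMeasure (frameMeasure p E) A) := by ring
        _ ≤ _ := by gcongr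
    · refine (mul_le_mul_right b2 c).trans ?_
      rw [mul_left_comm]
      refine (mul_le_mul_right a1 _).trans ?_
      rw [← mul_assoc, mul_comm (κ ^ _ : ℝ≥0∞)]
      gcongr
  have hcarried : (c • extendMeasure (frameMeasure p E)).restrict (frameSet (p + 1) E) =
      c • extendMeasure (frameMeasure p E) := by
    refine Measure.restrict_eq_self_of_ae_mem ?_
    refine Measure.ae_smul_measure ?_ c
    rw [ae_iff]
    have hm : MeasurableSet {w : Tuple (p + 1) E | w ∉ frameSet (p + 1) E} :=
      measurableSet_frameSet.compl
    change extendMeasure (frameMeasure p E) {w : Tuple (p + 1) E | w ∉ frameSet (p + 1) E} = 0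
    rw [extendMeasure_apply _ ae_frameMeasure_mem hp hm, ← lintegral_zero]
    refine lintegral_congr_ae ?_
    filter_upwards [ae_frameMeasure_mem] with u hu
    have h := ae_iff.1 (ae_fibreMeasure_mem u)
    refine measure_mono_null (fun v hv => ?_) h
    exact fun hv' => hv (snoc_mem_frameSet.2 ⟨hu, hv'⟩)
  rw [← hcarried, frameMeasure]
  refine le_antisymm ?_ ?_
  · refine measure_restrict_le_of_locally_le measurableSet_frameSet fun η hη w hw => ?_
    obtain ⟨N, hN, h⟩ := hloc η hη w hw
    exact ⟨N, hN, fun A hA hAN => (h A hA hAN).1⟩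
  · refine measure_restrict_le_of_locally_le measurableSet_frameSet fun η hη w hw => ?_
    obtain ⟨N, hN, h⟩ := hloc η hη w hw
    exact ⟨N, hN, fun A hA hAN => (h A hA hAN).2⟩

/-- Integration over the `(p + 1)`-frames, fibrewise over the `p`-frames. -/
theorem lintegral_frameMeasure_succ (hp : p < finrank ℝ E) {f : Tuple (p + 1) E → ℝ≥0∞}
    (hf : Measurable f) :
    ∫⁻ w, f w ∂(frameMeasure (p + 1) E) = ENNReal.ofReal (2 ^ ((p : ℝ) / 2)) *
      ∫⁻ u, ∫⁻ v, f (Tuple.snoc u v) ∂(fibreMeasure u) ∂(frameMeasure p E) := by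
  rw [frameMeasure_succ hp, lintegral_smul_measure,
    lintegral_extendMeasure _ ae_frameMeasure_mem hp hf, smul_eq_mul]

end FrameMeasure

/-! ### The mean length of a projection of a unit vector -/

theorem lintegral_pow_mul_exp_neg_sq (n : ℕ) :
    ∫⁻ r in Set.Ioi (0 : ℝ), ENNReal.ofReal (r ^ n) * ENNReal.ofReal (Real.exp (-r ^ 2)) =
      ENNReal.ofReal (Real.Gamma (((n : ℝ) + 1) / 2) / 2) := by
  have h1 := integral_rpow_mul_exp_neg_rpow (p := 2) (q := n) two_pos
    (by have : (0 : ℝ) ≤ n := by positivity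
        linarith)
  have h2 := integrableOn_rpow_mul_exp_neg_rpow (p := 2) (s := n)
    (by have : (0 : ℝ) ≤ n := by positivity
        linarith) two_pos
  have e : Real.Gamma (((n : ℝ) + 1) / 2) / 2 = 1 / 2 * Real.Gamma (((n : ℝ) + 1) / 2) := by ring
  rw [e, ← h1, ofReal_integral_eq_lintegral_ofReal h2]
  · refine setLIntegral_congr_fun measurableSet_Ioi fun r hr => ?_
    have hr : (0 : ℝ) < r := hr
    rw [← ENNReal.ofReal_mul (by positivity)]
    norm_cast
  · filter_upwards [ae_restrict_mem measurableSet_Ioi] with r hr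
    have hr : (0 : ℝ) < r := hr
    positivity

section Gauss
variable {W : Type*} [NormedAddCommGroup W] [InnerProductSpace ℝ W] [FiniteDimensional ℝ W]
  [MeasurableSpace W] [BorelSpace W]

theorem lintegral_exp_neg_norm_sq :
    ∫⁻ x : W, ENNReal.ofReal (Real.exp (-‖x‖ ^ 2)) =
      ENNReal.ofReal (Real.pi ^ ((finrank ℝ W : ℝ) / 2)) := by
  have h := GaussianFourier.integral_rexp_neg_mul_sq_norm (V := W) one_pos
  simp only [div_one] at h
  rw [← h, ofReal_integral_eq_lintegral_ofReal]
  · simp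
  · by_contra hc
    rw [integral_undef hc] at h
    have : (0 : ℝ) < Real.pi ^ ((finrank ℝ W : ℝ) / 2) := by positivity
    exact this.ne h
  · exact Filter.Eventually.of_forall fun x => by positivity

/-- The total surface measure of the unit sphere, from the Gaussian integral in polar
coordinates. -/
theorem sphereMeasure_univ_mul [Nontrivial W] :
    sphereMeasure W Set.univ * ENNReal.ofReal (Real.Gamma ((finrank ℝ W : ℝ) / 2) / 2) =
      ENNReal.ofReal (Real.pi ^ ((finrank ℝ W : ℝ) / 2)) := by
  have h := lintegral_polar (W := W) (g := fun _ => 1) measurable_const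
    (h := fun r => ENNReal.ofReal (Real.exp (-r ^ 2))) (by fun_prop)
  simp only [one_mul, lintegral_const] at h
  have hpos : 0 < finrank ℝ W := finrank_pos
  rw [lintegral_exp_neg_norm_sq, lintegral_pow_mul_exp_neg_sq, Nat.cast_pred hpos,
    sub_add_cancel] at h
  exact h.symm

theorem lintegral_norm_mul_exp_neg_norm_sq [Nontrivial W] :
    ∫⁻ x : W, ENNReal.ofReal ‖x‖ * ENNReal.ofReal (Real.exp (-‖x‖ ^ 2)) =
      sphereMeasure W Set.univ *
        ENNReal.ofReal (Real.Gamma (((finrank ℝ W : ℝ) + 1) / 2) / 2) := by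
  have h := lintegral_polar (W := W) (g := fun _ => 1) measurable_const
    (h := fun r => ENNReal.ofReal r * ENNReal.ofReal (Real.exp (-r ^ 2))) (by fun_prop)
  simp only [one_mul, lintegral_const] at h
  have hpos : 0 < finrank ℝ W := finrank_pos
  rw [h, ← lintegral_pow_mul_exp_neg_sq]
  congr 1
  refine setLIntegral_congr_fun measurableSet_Ioi fun r hr => ?_
  have hr : (0 : ℝ) < r := hr
  rw [← mul_assoc, ← ENNReal.ofReal_mul (by positivity), ← pow_succ, Nat.sub_add_cancel hpos]

/-- The integral over the unit sphere of the length of the orthogonal projection to an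
`m`-dimensional subspace, obtained by integrating the length of the projection against a Gaussian
in polar coordinates and by Fubini's theorem. -/
theorem lintegral_sphereMeasure_sqrt [Nontrivial W] {d m : ℕ} (hd : finrank ℝ W = d) (hm : 1 ≤ m)
    {g : Fin m → W} (hg : Orthonormal ℝ g) :
    ∫⁻ v, ENNReal.ofReal √(∑ j, ⟪g j, v⟫_ℝ ^ 2) ∂(sphereMeasure W) =
      ENNReal.ofReal (2 * Real.pi ^ ((d : ℝ) / 2) * Real.Gamma (((m : ℝ) + 1) / 2) /
        (Real.Gamma ((m : ℝ) / 2) * Real.Gamma (((d : ℝ) + 1) / 2))) := by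
  set G := Submodule.span ℝ (Set.range g) with hG
  have hGm : finrank ℝ G = m := by
    rw [hG, finrank_span_eq_card hg.linearIndependent, Fintype.card_fin]
  have hsum : finrank ℝ G + finrank ℝ Gᗮ = d := by
    rw [Submodule.finrank_add_finrank_orthogonal, hd]
  have : Nontrivial G := nontrivial_of_finrank_pos (R := ℝ) (by omega)
  have hproj : ∀ x : W, √(∑ j, ⟪g j, x⟫_ℝ ^ 2) = ‖G.orthogonalProjectionOnto x‖ := by
    intro x
    have h1 : G.starProjection x = ∑ j, ⟪g j, x⟫_ℝ • g j := by
      refine Submodule.eq_starProjection_of_mem_orthogonal (K := G) (Submodule.sum_mem _ fun i _ =>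
        Submodule.smul_mem _ _ (Submodule.subset_span ⟨i, rfl⟩)) ?_
      refine (Submodule.mem_orthogonal _ _).2 fun y hy => ?_
      induction hy using Submodule.span_induction with
      | mem y hy =>
        obtain ⟨i, rfl⟩ := hy
        rw [inner_sub_right, hg.inner_right_fintype, sub_self]
      | zero => simp
      | add y z _ _ hy hz => rw [inner_add_left, hy, hz, add_zero]
      | smul c y _ hy => rw [inner_smul_left, hy, mul_zero]
    have h2 : ‖G.orthogonalProjectionOnto x‖ = ‖G.starProjection x‖ := rfl
    rw [h2, h1, Real.sqrt_eq_iff_mul_self_eq (by positivity) (norm_nonneg _), ← pow_two,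
      ← real_inner_self_eq_norm_sq, sum_inner]
    refine Finset.sum_congr rfl fun i _ => ?_
    rw [inner_smul_left, hg.inner_right_fintype]
    simp [pow_two]
  set S := ∫⁻ v, ENNReal.ofReal √(∑ j, ⟪g j, v⟫_ℝ ^ 2) ∂(sphereMeasure W) with hS
  -- polar coordinates in `W`
  have hpolar := lintegral_polar (W := W)
    (g := fun v => ENNReal.ofReal √(∑ j, ⟪g j, v⟫_ℝ ^ 2)) (by fun_prop)
    (h := fun r => ENNReal.ofReal r * ENNReal.ofReal (Real.exp (-r ^ 2))) (by fun_prop)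
  have hpos : 0 < finrank ℝ W := finrank_pos
  have hrad : ∫⁻ r in Set.Ioi (0 : ℝ), ENNReal.ofReal (r ^ (finrank ℝ W - 1)) *
      (ENNReal.ofReal r * ENNReal.ofReal (Real.exp (-r ^ 2))) =
      ENNReal.ofReal (Real.Gamma (((d : ℝ) + 1) / 2) / 2) := by
    rw [← lintegral_pow_mul_exp_neg_sq]
    refine setLIntegral_congr_fun measurableSet_Ioi fun r hr => ?_
    have hr : (0 : ℝ) < r := hr
    rw [← mul_assoc, ← ENNReal.ofReal_mul (by positivity), ← pow_succ, Nat.sub_add_cancel hpos, hd]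
  rw [hrad, ← hS] at hpolar
  -- Fubini in `G × Gᗮ`
  have hfub : ∫⁻ x : W, ENNReal.ofReal √(∑ j, ⟪g j, ‖x‖⁻¹ • x⟫_ℝ ^ 2) *
      (ENNReal.ofReal ‖x‖ * ENNReal.ofReal (Real.exp (-‖x‖ ^ 2))) =
      (∫⁻ y : G, ENNReal.ofReal ‖y‖ * ENNReal.ofReal (Real.exp (-‖y‖ ^ 2))) *
        ∫⁻ z : Gᗮ, ENNReal.ofReal (Real.exp (-‖z‖ ^ 2)) := by
    rw [← lintegral_mul_orthogonal G (by fun_prop) (by fun_prop)]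
    refine lintegral_congr fun x => ?_
    rw [hproj, map_smul, norm_smul, norm_inv, norm_norm, ← mul_assoc,
      ← ENNReal.ofReal_mul (by positivity),
      mul_assoc (ENNReal.ofReal ‖G.orthogonalProjectionOnto x‖),
      ← ENNReal.ofReal_mul (Real.exp_pos _).le, ← Real.exp_add]
    congr 2
    · rcases eq_or_ne x 0 with rfl | hx
      · simp
      · have := norm_ne_zero_iff.2 hx
        field_simp
    · have := G.norm_sq_eq_add_norm_sq_starProjection x
      have h2 : ‖G.orthogonalProjectionOnto x‖ = ‖G.starProjection x‖ := rfl
      have h3 : ‖Gᗮ.orthogonalProjectionOnto x‖ = ‖Gᗮ.starProjection x‖ := rfl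
      rw [h2, h3, this]
      congr 1
      ring
  rw [hfub, lintegral_norm_mul_exp_neg_norm_sq, lintegral_exp_neg_norm_sq] at hpolar
  have hσ := sphereMeasure_univ_mul (W := G)
  rw [hGm] at hpolar hσ
  have hm0 : (0 : ℝ) < m := by exact_mod_cast hm
  have hd0 : (0 : ℝ) ≤ d := by positivity
  have g1 : 0 < Real.Gamma ((m : ℝ) / 2) := Real.Gamma_pos_of_pos (by positivity)
  have g2 : 0 < Real.Gamma (((m : ℝ) + 1) / 2) := Real.Gamma_pos_of_pos (by positivity)
  have g3 : 0 < Real.Gamma (((d : ℝ) + 1) / 2) := Real.Gamma_pos_of_pos (by positivity)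
  have hSt : S ≠ ∞ := by
    intro h
    rw [h, ENNReal.top_mul (by simpa using g3)] at hpolar
    exact (ENNReal.mul_ne_top (ENNReal.mul_ne_top (measure_ne_top _ _) ENNReal.ofReal_ne_top)
      ENNReal.ofReal_ne_top) hpolar
  have hpolar' := congrArg ENNReal.toReal hpolar
  have hσ' := congrArg ENNReal.toReal hσ
  simp only [ENNReal.toReal_mul] at hpolar' hσ'
  rw [ENNReal.toReal_ofReal (by positivity), ENNReal.toReal_ofReal (by positivity)] at hσ'
  rw [ENNReal.toReal_ofReal (by positivity), ENNReal.toReal_ofReal (by positivity),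
    ENNReal.toReal_ofReal (by positivity)] at hpolar'
  rw [← ENNReal.ofReal_toReal hSt]
  congr 1
  have hpi : Real.pi ^ ((d : ℝ) / 2) =
      Real.pi ^ ((m : ℝ) / 2) * Real.pi ^ ((finrank ℝ Gᗮ : ℝ) / 2) := by
    rw [← Real.rpow_add Real.pi_pos]
    congr 1
    rw [← hsum, hGm]
    push_cast
    ring
  rw [hpi, ← hσ', eq_div_iff (by positivity)]
  linear_combination (-2 * Real.Gamma ((m : ℝ) / 2)) * hpolar'

end Gauss

/-- The surface measure of the fibre over a frame, evaluated on the length of a projection. -/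
theorem lintegral_fibreMeasure_sqrt {E : Type*} [NormedAddCommGroup E] [InnerProductSpace ℝ E]
    [FiniteDimensional ℝ E] [MeasurableSpace E] [BorelSpace E] {p d m : ℕ} {u : Tuple p E}
    (hd : finrank ℝ (perp u) = d) (hm : 1 ≤ m)
    {g : Fin m → E} (hg : Orthonormal ℝ g) (hgu : ∀ j, g j ∈ perp u) :
    ∫⁻ v, ENNReal.ofReal √(∑ j, ⟪g j, v⟫_ℝ ^ 2) ∂(fibreMeasure u) =
      ENNReal.ofReal (2 * Real.pi ^ ((d : ℝ) / 2) * Real.Gamma (((m : ℝ) + 1) / 2) /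
        (Real.Gamma ((m : ℝ) / 2) * Real.Gamma (((d : ℝ) + 1) / 2))) := by
  let g' : Fin m → perp u := fun j => ⟨g j, hgu j⟩
  have hg' : Orthonormal ℝ g' := by
    rw [orthonormal_iff_ite] at hg ⊢
    exact hg
  have : Nontrivial (perp u) := ⟨g' ⟨0, hm⟩, 0, fun h => by
    have := hg'.1 ⟨0, hm⟩
    rw [h, norm_zero] at this
    exact zero_ne_one this⟩
  rw [fibreMeasure, lintegral_map (by fun_prop) measurable_subtype_coe,
    ← lintegral_sphereMeasure_sqrt hd hm hg']
  rfl

/-! ### Interior products of simple multivectors -/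

namespace Multivector

section Algebra
variable {F : Type*} [NormedAddCommGroup F] [InnerProductSpace ℝ F]

theorem wedge_ιMulti {l m : ℕ} (x : Fin l → F) (y : Fin m → F) :
    wedge rfl (exteriorPower.ιMulti ℝ l x) (exteriorPower.ιMulti ℝ m y) =
      exteriorPower.ιMulti ℝ (l + m) (Fin.append x y) :=
  Subtype.ext (ExteriorAlgebra.ιMulti_mul_ιMulti x y)

/-- Exterior multiplication by a vector, as a map from `m`-vectors to `(m + 1)`-vectors. -/
def wedgeVector (m : ℕ) (v : F) : ⋀[ℝ]^m F →ₗ[ℝ] ⋀[ℝ]^(m + 1) F :=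
  wedge (Nat.add_comm 1 m) (exteriorPower.ιMulti ℝ 1 fun _ => v)

theorem coe_wedgeVector {m : ℕ} (v : F) (ω : ⋀[ℝ]^m F) :
    (wedgeVector m v ω : ExteriorAlgebra ℝ F) = ExteriorAlgebra.ι ℝ v * ω := by
  change ExteriorAlgebra.ιMulti ℝ 1 (fun _ => v) * (ω : ExteriorAlgebra ℝ F) = _
  rw [ExteriorAlgebra.ιMulti_apply]
  simp

theorem wedgeVector_ιMulti {m : ℕ} (v : F) (x : Fin m → F) :
    wedgeVector m v (exteriorPower.ιMulti ℝ m x) =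
      exteriorPower.ιMulti ℝ (m + 1) (Fin.cons v x : Fin (m + 1) → F) := by
  refine Subtype.ext ?_
  rw [coe_wedgeVector]
  simp only [exteriorPower.ιMulti_apply_coe]
  rw [ExteriorAlgebra.ιMulti_succ_apply]
  rfl

theorem wedge_snoc {p m k : ℕ} (h : p + 1 + m = k) (h' : p + (m + 1) = k) (u : Tuple p F) (v : F)
    (ω : ⋀[ℝ]^m F) :
    wedge h (exteriorPower.ιMulti ℝ (p + 1) fun i => Tuple.snoc u v i) ω =
      wedge h' (exteriorPower.ιMulti ℝ p fun i => u i) (wedgeVector m v ω) := by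
  refine Subtype.ext ?_
  change ExteriorAlgebra.ιMulti ℝ (p + 1) (fun i => Tuple.snoc u v i) * (ω : ExteriorAlgebra ℝ F) =
    ExteriorAlgebra.ιMulti ℝ p (fun i => u i) * (wedgeVector m v ω : ExteriorAlgebra ℝ F)
  rw [coe_wedgeVector, ← mul_assoc]
  congr 1
  rw [ExteriorAlgebra.ιMulti_apply, ExteriorAlgebra.ιMulti_apply, List.ofFn_succ',
    List.concat_eq_append, List.prod_append]
  simp [Tuple.snoc_castSucc, Tuple.snoc_last]

/-- The exterior product of vectors of a subspace with a given basis is a multiple of the exterior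
product of the basis. -/
theorem ιMulti_eq_det_smul {m : ℕ} {W : Submodule ℝ F} (b : Basis (Fin m) ℝ W) (f : Fin m → W) :
    exteriorPower.ιMulti ℝ m (fun i => (f i : F)) =
      b.det f • exteriorPower.ιMulti ℝ m fun i => (b i : F) := by
  refine sub_eq_zero.1 ((Module.forall_dual_apply_eq_zero_iff ℝ _).1 fun φ => ?_)
  rw [map_sub, sub_eq_zero]
  have h := congrArg (fun A => A f)
    ((φ.compAlternatingMap
      ((exteriorPower.ιMulti ℝ m).compLinearMap W.subtype)).eq_smul_basis_det b)
  rw [map_smul, smul_eq_mul, mul_comm]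
  exact h

variable [FiniteDimensional ℝ F]

theorem norm_ιMulti_of_orthonormal {m : ℕ} {g : Fin m → F} (hg : Orthonormal ℝ g) :
    ‖exteriorPower.ιMulti ℝ m g‖ = 1 := by
  have h := exteriorPower.inner_ιMulti_self g
  rw [Matrix.gram_eq_one_iff_orthonormal.2 hg, Matrix.det_one, real_inner_self_eq_norm_sq] at h
  exact (pow_eq_one_iff_of_nonneg (norm_nonneg _) two_ne_zero).1 h

/-- A multivector is determined by its inner products with simple multivectors. -/
theorem ext_inner_ιMulti {m : ℕ} {ξ η : ⋀[ℝ]^m F}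
    (h : ∀ x : Fin m → F, ⟪exteriorPower.ιMulti ℝ m x, ξ⟫_ℝ = ⟪exteriorPower.ιMulti ℝ m x, η⟫_ℝ) :
    ξ = η := by
  refine ext_inner_left ℝ fun ω => ?_
  have hω : ω ∈ Submodule.span ℝ (Set.range (exteriorPower.ιMulti ℝ m (M := F))) := by
    rw [exteriorPower.ιMulti_span]; trivial
  induction hω using Submodule.span_induction with
  | mem y hy => obtain ⟨x, rfl⟩ := hy; exact h x
  | zero => simp
  | add y z _ _ hy hz => rw [inner_add_left, inner_add_left, hy, hz]
  | smul c y _ hy => rw [inner_smul_left, inner_smul_left, hy]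

/-- The interior product of a vector with a simple multivector whose factors after the first one are
orthogonal to the vector: Laplace expansion of the Gram determinants has a single term. -/
theorem adjoint_wedgeVector_of_inner_succ_eq_zero {m : ℕ} (v : F) (g : Fin (m + 1) → F)
    (hg : ∀ i : Fin m, ⟪v, g i.succ⟫_ℝ = 0) :
    LinearMap.adjoint (wedgeVector m v) (exteriorPower.ιMulti ℝ (m + 1) g) =
      ⟪v, g 0⟫_ℝ • exteriorPower.ιMulti ℝ m fun i => g i.succ := by
  refine ext_inner_ιMulti fun x => ?_
  rw [LinearMap.adjoint_inner_right, wedgeVector_ιMulti, exteriorPower.inner_ιMulti_ιMulti,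
    inner_smul_right, exteriorPower.inner_ιMulti_ιMulti, Matrix.det_succ_column_zero,
    Fin.sum_univ_succ]
  simp [hg]
  left
  rfl

/-- The interior product of a vector `v` with an orthonormal simple multivector: up to a sign it is
the length of the projection of `v` to the span times an orthonormal simple multivector orthogonal
to `v`. -/
theorem exists_adjoint_wedgeVector_eq {m : ℕ} (v : F) {f : Fin (m + 1) → F}
    (hf : Orthonormal ℝ f) :
    ∃ (c : ℝ) (g : Fin m → F), Orthonormal ℝ g ∧
      (∀ i, g i ∈ Submodule.span ℝ (Set.range f)) ∧ (∀ i, ⟪g i, v⟫_ℝ = 0) ∧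
      |c| = √(∑ j, ⟪f j, v⟫_ℝ ^ 2) ∧
      LinearMap.adjoint (wedgeVector m v) (exteriorPower.ιMulti ℝ (m + 1) f) =
        c • exteriorPower.ιMulti ℝ m g := by
  set W := Submodule.span ℝ (Set.range f) with hW
  have hfW : ∀ i, f i ∈ W := fun i => Submodule.subset_span ⟨i, rfl⟩
  set w : W := ∑ j, ⟪f j, v⟫_ℝ • ⟨f j, hfW j⟩ with hw
  have hwc : (w : F) = ∑ j, ⟪f j, v⟫_ℝ • f j := by simp [hw]
  -- `w` is the orthogonal projection of `v` to the span
  have hinner : ∀ y : W, ⟪v, (y : F)⟫_ℝ = ⟪w, y⟫_ℝ := by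
    rintro ⟨y, hy⟩
    change ⟪v, y⟫_ℝ = ⟪(w : F), y⟫_ℝ
    rw [hwc]
    induction hy using Submodule.span_induction with
    | mem y hy =>
      obtain ⟨i, rfl⟩ := hy
      rw [real_inner_comm, real_inner_comm (f i), hf.inner_right_fintype]
    | zero => simp
    | add y z _ _ hy hz => rw [inner_add_right, inner_add_right, hy, hz]
    | smul c y _ hy => rw [inner_smul_right, inner_smul_right, hy]
  have hnorm : √(∑ j, ⟪f j, v⟫_ℝ ^ 2) = ‖w‖ := by
    rw [Real.sqrt_eq_iff_mul_self_eq (by positivity) (norm_nonneg _), ← pow_two,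
      ← real_inner_self_eq_norm_sq, ← hinner, hwc, inner_sum]
    refine Finset.sum_congr rfl fun i _ => ?_
    rw [inner_smul_right, real_inner_comm, pow_two]
  rcases eq_or_ne w 0 with h0 | h0
  · have hv : ∀ i, ⟪v, f i⟫_ℝ = 0 := fun i => by rw [hinner ⟨f i, hfW i⟩, h0, inner_zero_left]
    refine ⟨0, fun i => f i.succ, hf.comp _ (Fin.succ_injective m), fun i => hfW _,
      fun i => by rw [real_inner_comm, hv], by rw [hnorm, h0, norm_zero, abs_zero], ?_⟩
    rw [adjoint_wedgeVector_of_inner_succ_eq_zero v f fun i => hv _, hv]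
  · have hw0 : ‖w‖ ≠ 0 := norm_ne_zero_iff.2 h0
    have hcard : finrank ℝ W = Fintype.card (Fin (m + 1)) :=
      finrank_span_eq_card hf.linearIndependent
    obtain ⟨b, hb⟩ := Orthonormal.exists_orthonormalBasis_extension_of_card_eq (𝕜 := ℝ) hcard
      (v := fun _ => (‖w‖⁻¹ : ℝ) • w) (s := {0}) (by
        refine ⟨fun i => ?_, fun i j hij => (hij (Subsingleton.elim _ _)).elim⟩
        change ‖(‖w‖⁻¹ : ℝ) • w‖ = 1
        rw [norm_smul, norm_inv, norm_norm, inv_mul_cancel₀ hw0])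
    have hb0 : b 0 = (‖w‖⁻¹ : ℝ) • w := hb 0 rfl
    have hwb : w = ‖w‖ • b 0 := by rw [hb0, smul_smul, mul_inv_cancel₀ hw0, one_smul]
    let e : OrthonormalBasis (Fin (m + 1)) ℝ W :=
      OrthonormalBasis.mk (v := fun i => (⟨f i, hfW i⟩ : W)) (by
        rw [orthonormal_iff_ite] at hf ⊢
        exact hf) (by
        refine (LinearIndependent.span_eq_top_of_card_eq_finrank' ?_ hcard.symm).ge
        refine LinearIndependent.of_comp W.subtype ?_
        exact hf.linearIndependent)
    have he : ∀ i, (e i : F) = f i := fun i => by simp [e]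
    have hbo : ∀ i j, ⟪(b i : F), (b j : F)⟫_ℝ = if i = j then 1 else 0 :=
      orthonormal_iff_ite.1 b.orthonormal
    have hdet : |b.toBasis.det e| = 1 := by
      rcases b.det_to_matrix_orthonormalBasis_real e with h | h <;> rw [h] <;> simp
    have hvb : ∀ i : Fin m, ⟪v, (b i.succ : F)⟫_ℝ = 0 := fun i => by
      rw [hinner, hwb, inner_smul_left]
      have := hbo 0 i.succ
      rw [if_neg (Fin.succ_ne_zero i).symm] at this
      change _ * ⟪(b 0 : F), (b i.succ : F)⟫_ℝ = 0
      rw [this, mul_zero]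
    have hvb0 : ⟪v, (b 0 : F)⟫_ℝ = ‖w‖ := by
      rw [hinner, hb0, inner_smul_right, real_inner_self_eq_norm_sq]
      field_simp
    have hfb := ιMulti_eq_det_smul b.toBasis e
    simp only [he, OrthonormalBasis.coe_toBasis] at hfb
    refine ⟨b.toBasis.det e * ‖w‖, fun i => (b i.succ : F), ?_, fun i => (b i.succ).2,
      fun i => by rw [real_inner_comm, hvb], by rw [abs_mul, hdet, one_mul, abs_norm, hnorm], ?_⟩
    · rw [orthonormal_iff_ite]
      intro i j
      rw [hbo]
      simp
    · change LinearMap.adjoint (wedgeVector m v) (exteriorPower.ιMulti ℝ (m + 1) fun i => f i) = _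
      rw [hfb, map_smul, adjoint_wedgeVector_of_inner_succ_eq_zero v _ hvb, hvb0, smul_smul]

/-- The interior product with `u₁ ∧ ⋯ ∧ u_p ∧ v` is the interior product with `u₁ ∧ ⋯ ∧ u_p`
followed by the one with `v`. -/
theorem adjoint_wedge_snoc {p m k : ℕ} (h : p + 1 + m = k) (h' : p + (m + 1) = k) (u : Tuple p F)
    (v : F) (ξ : ⋀[ℝ]^k F) :
    LinearMap.adjoint (wedge h (exteriorPower.ιMulti ℝ (p + 1) fun i => Tuple.snoc u v i)) ξ =
      LinearMap.adjoint (wedgeVector m v)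
        (LinearMap.adjoint (wedge h' (exteriorPower.ιMulti ℝ p fun i => u i)) ξ) := by
  refine ext_inner_left ℝ fun ω => ?_
  rw [LinearMap.adjoint_inner_right, LinearMap.adjoint_inner_right, LinearMap.adjoint_inner_right,
    wedge_snoc h h']

/-- The interior product of two simple multivectors is a multiple of an orthonormal simple
multivector in the span of the second one, orthogonal to the first one. -/
theorem exists_adjoint_wedge_eq {p : ℕ} : ∀ {m k : ℕ} (h : p + m = k) (u : Tuple p F)
    {f : Fin k → F}, Orthonormal ℝ f →
    ∃ (c : ℝ) (g : Fin m → F), Orthonormal ℝ g ∧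
      (∀ i, g i ∈ Submodule.span ℝ (Set.range f)) ∧ (∀ i j, ⟪g i, u j⟫_ℝ = 0) ∧
      LinearMap.adjoint (wedge h (exteriorPower.ιMulti ℝ p fun i => u i))
        (exteriorPower.ιMulti ℝ k f) = c • exteriorPower.ιMulti ℝ m g := by
  induction p with
  | zero =>
    intro m k h u f hf
    obtain rfl : m = k := by omega
    refine ⟨1, f, hf, fun i => Submodule.subset_span ⟨i, rfl⟩, fun i j => j.elim0, ?_⟩
    refine ext_inner_left ℝ fun ω => ?_
    rw [LinearMap.adjoint_inner_right, one_smul]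
    congr 1
    refine Subtype.ext ?_
    change ExteriorAlgebra.ιMulti ℝ 0 (fun i => u i) * (ω : ExteriorAlgebra ℝ F) = ω
    rw [ExteriorAlgebra.ιMulti_zero_apply, one_mul]
  | succ p ih =>
    intro m k h u f hf
    obtain ⟨c, g, hg, hgf, hgu, hc⟩ := ih (m := m + 1) (by omega) (Tuple.init u) hf
    obtain ⟨c', g', hg', hgf', hgv, -, hc'⟩ := exists_adjoint_wedgeVector_eq (Tuple.last u) hg
    refine ⟨c * c', g', hg', fun i => ?_, fun i j => ?_, ?_⟩
    · exact Submodule.span_le.2 (by rintro _ ⟨j, rfl⟩; exact hgf j) (hgf' i)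
    · rw [← Tuple.snoc_init_last u]
      induction j using Fin.lastCases with
      | last => rw [Tuple.snoc_last, hgv]
      | cast j =>
        rw [Tuple.snoc_castSucc]
        refine Submodule.span_induction (p := fun y _ => ⟪y, Tuple.init u j⟫_ℝ = 0) ?_ ?_ ?_ ?_
          (hgf' i)
        · rintro _ ⟨l, rfl⟩; exact hgu l j
        · simp
        · intro y z _ _ hy hz; rw [inner_add_left, hy, hz, add_zero]
        · intro a y _ hy; rw [inner_smul_left, hy, mul_zero]
    · rw [← Tuple.snoc_init_last u, adjoint_wedge_snoc h (by omega), hc, map_smul, hc', smul_smul]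

/-- A nonzero simple multivector in a subspace is a multiple of an orthonormal one. -/
theorem exists_eq_smul_orthonormal {k : ℕ} {Z : Submodule ℝ F} {μ : ⋀[ℝ]^k F}
    (hμ : μ ∈ simpleVectors k Z) (h0 : μ ≠ 0) :
    ∃ (c : ℝ) (f : Fin k → F), Orthonormal ℝ f ∧ (∀ i, f i ∈ Z) ∧
      μ = c • exteriorPower.ιMulti ℝ k f := by
  obtain ⟨v, hv, rfl⟩ := hμ
  have hli : LinearIndependent ℝ v := by
    by_contra h
    exact h0 ((exteriorPower.ιMulti ℝ k).map_linearDependent v h)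
  set W := Submodule.span ℝ (Set.range v) with hW
  have hWZ : W ≤ Z := Submodule.span_le.2 (by rintro _ ⟨i, rfl⟩; exact hv i)
  have hcard : finrank ℝ W = k := by
    rw [hW, finrank_span_eq_card hli, Fintype.card_fin]
  let b : OrthonormalBasis (Fin k) ℝ W := (stdOrthonormalBasis ℝ W).reindex (finCongr hcard)
  refine ⟨b.toBasis.det fun i => ⟨v i, Submodule.subset_span ⟨i, rfl⟩⟩, fun i => (b i : F), ?_,
    fun i => hWZ (b i).2, ?_⟩
  · have := b.orthonormal
    rw [orthonormal_iff_ite] at this ⊢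
    exact this
  · have := ιMulti_eq_det_smul b.toBasis fun i => (⟨v i, Submodule.subset_span ⟨i, rfl⟩⟩ : W)
    simpa only [OrthonormalBasis.coe_toBasis] using this

/-- The length of an interior product, with the degree `k - l` replaced by any `m` with
`l + m = k`. -/
theorem norm_interiorProduct_eq {l m k : ℕ} (h : l + m = k) (h' : l ≤ k) (ν : ⋀[ℝ]^l F)
    (ξ : ⋀[ℝ]^k F) : ‖interiorProduct h' ν ξ‖ = ‖LinearMap.adjoint (wedge h ν) ξ‖ := by
  obtain rfl : m = k - l := by omega
  rfl

/-- The interior product with `u₁ ∧ ⋯ ∧ u_p ∧ v` has the length of the interior product with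
`u₁ ∧ ⋯ ∧ u_p` times the length of the projection of `v` to a `(k - p)`-dimensional subspace
orthogonal to `u₁, …, u_p`. The subspace is given by an orthonormal basis; it exists unless the
multivector vanishes. -/
theorem exists_norm_interiorProduct_snoc {p k : ℕ} (hp : p ≤ k) (hp1 : p + 1 ≤ k)
    {Z : Submodule ℝ F} {μ : ⋀[ℝ]^k F} (hμ : μ ∈ simpleVectors k Z) (h0 : μ ≠ 0) (u : Tuple p F) :
    ∃ g : Fin (k - p) → F, Orthonormal ℝ g ∧ (∀ i, g i ∈ Z) ∧ (∀ i j, ⟪g i, u j⟫_ℝ = 0) ∧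
      ∀ v : F, ‖interiorProduct hp1 (exteriorPower.ιMulti ℝ (p + 1) fun i => Tuple.snoc u v i) μ‖ =
        ‖interiorProduct hp (exteriorPower.ιMulti ℝ p fun i => u i) μ‖ *
          √(∑ j, ⟪g j, v⟫_ℝ ^ 2) := by
  obtain ⟨a, f, hf, hfZ, rfl⟩ := exists_eq_smul_orthonormal hμ h0
  suffices H : ∀ (m r : ℕ) (hr : p + r = k), r = m + 1 → ∃ g : Fin r → F, Orthonormal ℝ g ∧
      (∀ i, g i ∈ Z) ∧ (∀ i j, ⟪g i, u j⟫_ℝ = 0) ∧ ∀ v : F,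
        ‖interiorProduct hp1 (exteriorPower.ιMulti ℝ (p + 1) fun i => Tuple.snoc u v i)
          (a • exteriorPower.ιMulti ℝ k f)‖ =
        ‖interiorProduct hp (exteriorPower.ιMulti ℝ p fun i => u i)
          (a • exteriorPower.ιMulti ℝ k f)‖ * √(∑ j, ⟪g j, v⟫_ℝ ^ 2) from
    H (k - p - 1) (k - p) (by omega) (by omega)
  rintro m _ hr rfl
  obtain ⟨c, g, hg, hgf, hgu, hc⟩ := exists_adjoint_wedge_eq hr u hf
  refine ⟨g, hg, fun i => Submodule.span_le.2 (by rintro _ ⟨j, rfl⟩; exact hfZ j) (hgf i), hgu,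
    fun v => ?_⟩
  obtain ⟨c', g', hg', -, -, hcc, hc'⟩ := exists_adjoint_wedgeVector_eq v hg
  rw [norm_interiorProduct_eq (show p + 1 + m = k by omega), norm_interiorProduct_eq hr,
    adjoint_wedge_snoc _ hr, map_smul, hc, map_smul, map_smul, hc',
    norm_smul, norm_smul, norm_smul, norm_smul, norm_smul, norm_ιMulti_of_orthonormal hg,
    norm_ιMulti_of_orthonormal hg', Real.norm_eq_abs c', hcc]
  ring

theorem continuous_norm_interiorProduct {p k : ℕ} (hp : p ≤ k) {Z : Submodule ℝ F}
    {μ : ⋀[ℝ]^k F} (hμ : μ ∈ simpleVectors k Z) :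
    Continuous fun u : Tuple p F =>
      ‖interiorProduct hp (exteriorPower.ιMulti ℝ p fun i => u i) μ‖ := by
  obtain ⟨v, -, rfl⟩ := hμ
  obtain ⟨m, rfl⟩ : ∃ m, k = p + m := ⟨k - p, by omega⟩
  simp_rw [norm_interiorProduct_eq (rfl : p + m = p + m)]
  refine Continuous.norm ?_
  have key : ∀ ω : ⋀[ℝ]^m F, Continuous fun u : Tuple p F =>
      ⟪ω, LinearMap.adjoint (wedge rfl (exteriorPower.ιMulti ℝ p fun i => u i))
        (exteriorPower.ιMulti ℝ (p + m) v)⟫_ℝ := by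
    intro ω
    simp_rw [LinearMap.adjoint_inner_right]
    have hω : ω ∈ Submodule.span ℝ (Set.range (exteriorPower.ιMulti ℝ m (M := F))) := by
      rw [exteriorPower.ιMulti_span]; trivial
    induction hω using Submodule.span_induction with
    | mem y hy =>
      obtain ⟨x, rfl⟩ := hy
      simp_rw [wedge_ιMulti, exteriorPower.inner_ιMulti_ιMulti]
      refine Continuous.matrix_det (continuous_matrix fun i j => ?_)
      simp only [Matrix.of_apply]
      refine Continuous.inner ?_ continuous_const
      induction j using Fin.addCases with
      | left j => simp only [Fin.append_left]; fun_prop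
      | right j => simp only [Fin.append_right]; fun_prop
    | zero => simpa using continuous_const
    | add y z _ _ hy hz => simp only [map_add, inner_add_left]; exact hy.add hz
    | smul c y _ hy => simp only [map_smul, inner_smul_left]; exact continuous_const.mul hy
  let b := stdOrthonormalBasis ℝ (⋀[ℝ]^m F)
  refine Continuous.congr ?_ fun u => b.sum_repr' _
  exact continuous_finsetSum _ fun i _ => (key (b i)).smul continuous_const

end Algebra

end Multivector

/-! ### Frames in a subspace -/

section Subspace
variable {F : Type*} [NormedAddCommGroup F] [InnerProductSpace ℝ F] {p : ℕ} (Z : Submodule ℝ F)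

/-- The isometric inclusion of tuples in a subspace into tuples in the ambient space. -/
def Tuple.incl (u : Tuple p Z) : Tuple p F := WithLp.toLp 2 fun i => (u i : F)

theorem Tuple.isometry_incl : Isometry (Tuple.incl Z : Tuple p Z → Tuple p F) :=
  Isometry.of_dist_eq fun x y => by
    rw [PiLp.dist_eq_of_L2, PiLp.dist_eq_of_L2]
    rfl

theorem Tuple.incl_snoc (u : Tuple p Z) (v : Z) :
    Tuple.incl Z (Tuple.snoc u v) = Tuple.snoc (Tuple.incl Z u) (v : F) := by
  ext i
  induction i using Fin.lastCases with
  | last => rw [Tuple.snoc_last]; change ((Tuple.snoc u v (Fin.last p) : Z) : F) = _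
            rw [Tuple.snoc_last]
  | cast j => rw [Tuple.snoc_castSucc]; change ((Tuple.snoc u v j.castSucc : Z) : F) = _
              rw [Tuple.snoc_castSucc]; rfl

theorem mem_orthonormalFrames_iff {u : Tuple p F} :
    u ∈ Multivector.orthonormalFrames p Z ↔ (∀ i, u i ∈ Z) ∧ Orthonormal ℝ u := by
  refine and_congr_right fun _ => and_congr_right fun _ => ⟨fun h i j hij => ?_, fun h i j hij =>
    h hij.ne⟩
  rcases lt_or_gt_of_ne hij with h' | h'
  · exact h i j h'
  · rw [real_inner_comm]
    exact h j i h'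

theorem preimage_incl_orthonormalFrames :
    Tuple.incl Z ⁻¹' Multivector.orthonormalFrames p Z = frameSet p Z := by
  ext u
  rw [Set.mem_preimage, mem_orthonormalFrames_iff, frameSet, Set.mem_ofPred_eq,
    orthonormal_iff_ite, orthonormal_iff_ite]
  exact ⟨fun h => h.2, fun h => ⟨fun i => (u i).2, h⟩⟩

theorem orthonormalFrames_subset_range :
    Multivector.orthonormalFrames p Z ⊆ Set.range (Tuple.incl Z : Tuple p Z → Tuple p F) :=
  fun u hu => ⟨WithLp.toLp 2 fun i => ⟨u i, hu.1 i⟩, rfl⟩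

variable [FiniteDimensional ℝ F] [MeasurableSpace F] [BorelSpace F]

theorem measurableSet_orthonormalFrames :
    MeasurableSet (Multivector.orthonormalFrames p Z) := by
  have : Multivector.orthonormalFrames p Z = Tuple.incl Z '' frameSet p Z := by
    rw [← preimage_incl_orthonormalFrames, Set.image_preimage_eq_of_subset
      (orthonormalFrames_subset_range Z)]
  rw [this]
  exact (isCompact_frameSet.image (Tuple.isometry_incl Z).continuous).measurableSet

/-- The Hausdorff measure on the frames of a subspace does not depend on the ambient space. -/
theorem restrict_orthonormalFrames {D : ℕ} (hD : D = frameDim (finrank ℝ Z) p) :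
    (μHE[D] : Measure (Tuple p F)).restrict (Multivector.orthonormalFrames p Z) =
      (frameMeasure p Z).map (Tuple.incl Z) := by
  have h := (Tuple.isometry_incl Z (p := p)).map_euclideanHausdorffMeasure (d := D)
  rw [frameMeasure, ← hD, ← preimage_incl_orthonormalFrames, ← Measure.restrict_map
    (Tuple.isometry_incl Z).continuous.measurable (measurableSet_orthonormalFrames Z), h,
    Measure.restrict_restrict (measurableSet_orthonormalFrames Z), Set.inter_eq_left.2
    (orthonormalFrames_subset_range Z)]

end Subspace

/-! ### The reduction formula -/

section Reduction
open Multivector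
variable {F : Type*} [NormedAddCommGroup F] [InnerProductSpace ℝ F] [FiniteDimensional ℝ F]
  [MeasurableSpace F] [BorelSpace F] {p k : ℕ} {Z : Submodule ℝ F} {μ : ⋀[ℝ]^k F}

theorem integrableOn_norm_interiorProduct (hp : p ≤ k) (hμ : μ ∈ simpleVectors k Z) {D : ℕ}
    (hD : D = frameDim (finrank ℝ Z) p) :
    IntegrableOn (fun u : Tuple p F =>
      ‖interiorProduct hp (exteriorPower.ιMulti ℝ p fun i => u i) μ‖)
      (orthonormalFrames p Z) μHE[D] := by
  have hcont := continuous_norm_interiorProduct hp hμ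
  have hincl := (Tuple.isometry_incl Z (p := p)).continuous
  rw [IntegrableOn, restrict_orthonormalFrames Z hD,
    integrable_map_measure hcont.aestronglyMeasurable hincl.measurable.aemeasurable]
  obtain ⟨C, hC⟩ := (isCompact_frameSet (p := p) (E := Z)).exists_bound_of_continuousOn
    (hcont.comp hincl).continuousOn
  refine Integrable.of_bound (hcont.comp hincl).aestronglyMeasurable C ?_
  filter_upwards [ae_frameMeasure_mem] with u hu using hC u hu

theorem setIntegral_norm_interiorProduct (hp : p ≤ k) (hμ : μ ∈ simpleVectors k Z) {D : ℕ}
    (hD : D = frameDim (finrank ℝ Z) p) :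
    ∫ u in orthonormalFrames p Z,
        ‖interiorProduct hp (exteriorPower.ιMulti ℝ p fun i => (u : Tuple p F) i) μ‖ ∂μHE[D] =
      (∫⁻ u, ENNReal.ofReal ‖interiorProduct hp
        (exteriorPower.ιMulti ℝ p fun i => Tuple.incl Z u i) μ‖ ∂frameMeasure p Z).toReal := by
  have hcont := continuous_norm_interiorProduct hp hμ
  rw [integral_eq_lintegral_of_nonneg_ae (Filter.Eventually.of_forall fun u => norm_nonneg _)
    hcont.aestronglyMeasurable, restrict_orthonormalFrames Z hD,
    lintegral_map hcont.measurable.ennreal_ofReal (Tuple.isometry_incl Z).continuous.measurable]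

/-- Integration of the length of an interior product over the last vector of a frame. -/
theorem lintegral_frameMeasure_norm_interiorProduct_succ (hp : p + 1 ≤ k)
    (hq : p + 1 ≤ finrank ℝ Z) (hμ : μ ∈ simpleVectors k Z) :
    ∫⁻ w, ENNReal.ofReal ‖interiorProduct hp
        (exteriorPower.ιMulti ℝ (p + 1) fun i => Tuple.incl Z w i) μ‖ ∂frameMeasure (p + 1) Z =
      ENNReal.ofReal (2 ^ ((p : ℝ) / 2)) *
        ((∫⁻ u, ENNReal.ofReal ‖interiorProduct (by omega : p ≤ k)
        (exteriorPower.ιMulti ℝ p fun i => Tuple.incl Z u i) μ‖ ∂frameMeasure p Z) *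
        ENNReal.ofReal (2 * Real.pi ^ (((finrank ℝ Z - p : ℕ) : ℝ) / 2) *
          Real.Gamma ((((k - p : ℕ) : ℝ) + 1) / 2) /
        (Real.Gamma (((k - p : ℕ) : ℝ) / 2) *
          Real.Gamma ((((finrank ℝ Z - p : ℕ) : ℝ) + 1) / 2)))) := by
  have hcont := continuous_norm_interiorProduct hp hμ
  have hcont' := continuous_norm_interiorProduct (by omega : p ≤ k) hμ
  have hm : Measurable fun w : Tuple (p + 1) Z => ENNReal.ofReal ‖interiorProduct hp
      (exteriorPower.ιMulti ℝ (p + 1) fun i => Tuple.incl Z w i) μ‖ :=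
    (hcont.comp (Tuple.isometry_incl Z).continuous).measurable.ennreal_ofReal
  have hm' : Measurable fun u : Tuple p Z => ENNReal.ofReal ‖interiorProduct (by omega : p ≤ k)
      (exteriorPower.ιMulti ℝ p fun i => Tuple.incl Z u i) μ‖ :=
    (hcont'.comp (Tuple.isometry_incl Z).continuous).measurable.ennreal_ofReal
  rw [lintegral_frameMeasure_succ (by omega) hm, ← lintegral_mul_const _ hm']
  congr 1
  refine lintegral_congr_ae ?_
  filter_upwards [ae_frameMeasure_mem] with u hu
  simp only [Tuple.incl_snoc]
  rcases eq_or_ne μ 0 with rfl | h0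
  · simp [interiorProduct]
  obtain ⟨g, hg, hgZ, hgu, hint⟩ := exists_norm_interiorProduct_snoc (by omega : p ≤ k) hp hμ h0
    (Tuple.incl Z u)
  simp_rw [hint, ENNReal.ofReal_mul (norm_nonneg _)]
  rw [lintegral_const_mul _ (by fun_prop)]
  congr 1
  have hg' : Orthonormal ℝ (fun j => (⟨g j, hgZ j⟩ : Z)) := by
    rw [orthonormal_iff_ite] at hg ⊢
    exact hg
  exact lintegral_fibreMeasure_sqrt (by have := finrank_perp hu; omega) (by omega) hg'
    fun j => mem_perp.2 fun i => (real_inner_comm _ _).trans (hgu j i)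

end Reduction

end

theorem lemma4p1 (n q k p : ℕ) (Z : Submodule ℝ (EuclideanSpace ℝ (Fin n)))
    (hq : Module.finrank ℝ Z = q)
    (μ : ⋀[ℝ]^k (EuclideanSpace ℝ (Fin n))) (hμ : μ ∈ Multivector.simpleVectors k Z)
    (hp : 1 ≤ p) (hpk : p ≤ k) (hpq : p ≤ q) :
    MeasureTheory.IntegrableOn
        (fun u : PiLp 2 (fun _ : Fin p => EuclideanSpace ℝ (Fin n)) =>
          ‖Multivector.interiorProduct hpk (exteriorPower.ιMulti ℝ p (fun i => u i)) μ‖)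
        (Multivector.orthonormalFrames p Z) μHE[p * (2 * q - p - 1) / 2] ∧
    MeasureTheory.IntegrableOn
        (fun u : PiLp 2 (fun _ : Fin (p - 1) => EuclideanSpace ℝ (Fin n)) =>
          ‖Multivector.interiorProduct ((Nat.sub_le p 1).trans hpk)
            (exteriorPower.ιMulti ℝ (p - 1) (fun i => u i)) μ‖)
        (Multivector.orthonormalFrames (p - 1) Z) μHE[(p - 1) * (2 * q - p) / 2] ∧
    ∫ u in Multivector.orthonormalFrames p Z,
        ‖Multivector.interiorProduct hpk (exteriorPower.ιMulti ℝ p (fun i => u i)) μ‖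
          ∂μHE[p * (2 * q - p - 1) / 2] =
      (2 : ℝ) ^ (((p : ℝ) + 1) / 2) * Real.pi ^ (((q : ℝ) - p + 1) / 2) *
          Real.Gamma (((k : ℝ) - p + 2) / 2) /
        (Real.Gamma (((k : ℝ) - p + 1) / 2) * Real.Gamma (((q : ℝ) - p + 2) / 2)) *
      ∫ u in Multivector.orthonormalFrames (p - 1) Z,
        ‖Multivector.interiorProduct ((Nat.sub_le p 1).trans hpk)
            (exteriorPower.ιMulti ℝ (p - 1) (fun i => u i)) μ‖
          ∂μHE[(p - 1) * (2 * q - p) / 2] := by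
  obtain ⟨r, rfl⟩ : ∃ r, p = r + 1 := ⟨p - 1, by omega⟩
  have hD : (r + 1) * (2 * q - (r + 1) - 1) / 2 = frameDim (Module.finrank ℝ Z) (r + 1) := by
    rw [hq, frameDim]
  have hD' : r * (2 * q - (r + 1)) / 2 = frameDim (Module.finrank ℝ Z) r := by
    rw [hq, frameDim, Nat.sub_sub]
  refine ⟨integrableOn_norm_interiorProduct hpk hμ hD,
    integrableOn_norm_interiorProduct (Nat.le_of_succ_le hpk) hμ hD', ?_⟩
  have e1 := setIntegral_norm_interiorProduct hpk hμ hD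
  have e2 := setIntegral_norm_interiorProduct (Nat.le_of_succ_le hpk) hμ hD'
  refine e1.trans (Eq.trans ?_ (congrArg _ e2.symm))
  have c1 : (((Module.finrank ℝ Z - r : ℕ) : ℝ)) = (q : ℝ) - r := by
    rw [hq, Nat.cast_sub (by omega)]
  have c2 : (((k - r : ℕ) : ℝ)) = (k : ℝ) - r := Nat.cast_sub (by omega)
  rw [lintegral_frameMeasure_norm_interiorProduct_succ hpk (by omega) hμ, ENNReal.toReal_mul,
    ENNReal.toReal_mul, ENNReal.toReal_ofReal (by positivity), ENNReal.toReal_ofReal (by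
      have g1 : 0 < Real.Gamma (((k - r : ℕ) : ℝ) / 2) := Real.Gamma_pos_of_pos (by
        have : 0 < k - r := by omega
        positivity)
      have g2 : 0 < Real.Gamma ((((k - r : ℕ) : ℝ) + 1) / 2) :=
        Real.Gamma_pos_of_pos (by positivity)
      have g3 : 0 < Real.Gamma ((((Module.finrank ℝ Z - r : ℕ) : ℝ) + 1) / 2) :=
        Real.Gamma_pos_of_pos (by positivity)
      positivity), c1, c2]
  have h2 : (2 : ℝ) ^ ((((r + 1 : ℕ) : ℝ) + 1) / 2) = 2 ^ ((r : ℝ) / 2) * 2 := by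
    rw [← Real.rpow_add_one two_ne_zero]
    congr 1
    push_cast
    ring
  rw [h2]
  push_cast
  have a1 : (q : ℝ) - (r + 1) + 1 = q - r := by ring
  have a2 : (k : ℝ) - (r + 1) + 2 = k - r + 1 := by ring
  have a3 : (k : ℝ) - (r + 1) + 1 = k - r := by ring
  have a4 : (q : ℝ) - (r + 1) + 2 = q - r + 1 := by ring
  rw [a1, a2, a3, a4]
  change _ = _ * ENNReal.toReal _
  ring
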